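/- Let $\mathbb{Z}^2$ denote the square lattice, i.e. the graph on the vertex set $\mathbb{Z}\times\mathbb{Z}$ in which $(x,y)$ and $(x',y')$ are adjacent if and only if $|x-x'|+|y-y'|=1$. For a graph $X$ write $d_X$ for its graph distance. A geodesic between two vertices is a path of minimum length between them. For vertices $u,v$ of $X$ and an integer $k$, let the geodesic slice $S_X(u,v,k)$ be the set of vertices $w$ that lie on a geodesic in $X$ between $u$ and $v$ and satisfy $d_X(u,w)=k$. **Theorem.** The square lattice $\mathbb{Z}^2$ is geodesically directable, i.e. it has a bounded extension with bounded geodesic slices. Explicitly, there is a graph $G$ on the vertex set $\mathbb{Z}\times\mathbb{Z}$ such that 1. every edge of $\mathbb{Z}^2$ is an edge of $G$, and there is a constant $M$ such that $d_{\mathbb{Z}^2}(u,v)\le M$ for every edge $uv$ of $G$; 2. there is a constant $B$ such that $|S_G(u,v,k)|\le B$ for all vertices $u,v$ and all integers $k$. -/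

import Mathlib

/-- The square lattice: the graph on `ℤ × ℤ` in which two vertices are adjacent if and only if
they differ by exactly `1` in one coordinate and agree in the other. -/
def squareLattice : SimpleGraph (ℤ × ℤ) where
  Adj u v := |u.1 - v.1| + |u.2 - v.2| = 1
  symm := ⟨fun u v h => by rw [abs_sub_comm v.1 u.1, abs_sub_comm v.2 u.2]; exact h⟩
  loopless := ⟨fun u h => by simp at h⟩

namespace SimpleGraph

variable {V : Type*}

/-- `X` is a bounded extension of `Y` (on the same vertex set): `Y` is a subgraph of `X`, and the
distance in `Y` between the endpoints of an edge of `X` is uniformly bounded.  The extended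
distance `edist` is used, so the endpoints of an edge of `X` have to be connected in `Y`. -/
def IsBoundedExtension (X Y : SimpleGraph V) : Prop :=
  Y ≤ X ∧ ∃ M : ℕ, ∀ u v : V, X.Adj u v → Y.edist u v ≤ (M : ℕ∞)

/-- A walk is a geodesic if no walk between its endpoints is shorter. -/
def Walk.IsGeodesic {X : SimpleGraph V} {u v : V} (p : X.Walk u v) : Prop :=
  ∀ q : X.Walk u v, p.length ≤ q.length

/-- The geodesic slice `S_X(u, v, k)`: the set of vertices that lie on a geodesic of `X` between
`u` and `v` and have distance `k` from `u` in `X`.  (A vertex on a walk from `u` is reachable from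
`u`, so `dist` takes no junk value here.) -/
def geodesicSlice (X : SimpleGraph V) (u v : V) (k : ℤ) : Set V :=
  {w | (∃ p : X.Walk u v, p.IsGeodesic ∧ w ∈ p.support) ∧ (X.dist u w : ℤ) = k}

/-- `X` has bounded geodesic slices: the sizes of the geodesic slices `S_X(u, v, k)` are bounded
uniformly in the vertices `u`, `v` and the integer `k` (in particular all slices are finite). -/
def HasBoundedGeodesicSlices (X : SimpleGraph V) : Prop :=
  ∃ B : ℕ, ∀ (u v : V) (k : ℤ), (X.geodesicSlice u v k).encard ≤ (B : ℕ∞)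

/-- `L` is geodesically directable: it has a bounded extension with bounded geodesic slices. -/
def GeodesicallyDirectable (L : SimpleGraph V) : Prop :=
  ∃ G : SimpleGraph V, G.IsBoundedExtension L ∧ G.HasBoundedGeodesicSlices

end SimpleGraph

/-! In the plain lattice every monotone staircase is a geodesic; the extension must break these ties
at all scales. Take a grid of roads in which each crossing gives priority to its column or its row,
and an edge ending at a crossing where its own line loses weighs 2 instead of 1. Column `x` wins
over row `y` if the largest power of 16 dividing `y` divides `x` (`Priority`), so lines divisible by
higher powers of 16 are delayed more rarely.

Compare a geodesic through the interior of a cell bounded by fast lines with routes along the sides.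
It cannot meet the same side twice or cut a corner; if it joins the two vertical sides, it is
trapped in a slow horizontal strip, so its length is close to its horizontal extent
(`IsCell.alternative`). Use this for a square cell and, with the axes exchanged, for a tall cell
around it: what remains is a vertical crossing inside a horizontal one, which `not_cross_both`
excludes. Hence, away from its endpoints, a geodesic that is not almost axis-parallel follows the
lines divisible by `16 ^ j` (`dvd_or_dvd_of_geodesic`).

For a given slice, choose the finest scale whose coarser neighbour is too coarse for this argument.
The slice then lies in a box of boundedly many cells (`exists_slice_box`), and each of its points is
determined by a nearby corner, a direction and a delay of 0 or 1 (`exists_eq_nearCorner`), which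
bounds the slice.

Finally, the grid is dilated by 2 and each edge of weight 1 becomes a chord (`roadGraph`). Roads are
almost twice as fast as the lattice, so geodesics leave the road grid only for bounded stretches at
their ends, and the bound carries over (`near_or_exists_roadGeodesic`). -/

/-! ### The weighted lattice and its distance. -/

/-- Moving along a road: the vertices `p`, `q` are neighbours in the square lattice and the edge
between them has weight `c`.  `D x y` says that column `x` has priority over row `y`; an edge has
weight `2` if one of its endpoints lies on a transversal line of higher priority, and weight `1`
otherwise. -/
def RoadStep (D : ℤ → ℤ → Prop) (p q : ℤ × ℤ) (c : ℤ) : Prop :=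
  (p.2 = q.2 ∧ |p.1 - q.1| = 1 ∧
    ((D p.1 p.2 ∨ D q.1 q.2) ∧ c = 2 ∨ ¬(D p.1 p.2 ∨ D q.1 q.2) ∧ c = 1)) ∨
  (p.1 = q.1 ∧ |p.2 - q.2| = 1 ∧
    ((¬D p.1 p.2 ∨ ¬D q.1 q.2) ∧ c = 2 ∨ ¬(¬D p.1 p.2 ∨ ¬D q.1 q.2) ∧ c = 1))

/-- There is a lattice path from `p` to `q` of total weight `n`. -/
inductive RoadPath (D : ℤ → ℤ → Prop) : ℤ × ℤ → ℤ × ℤ → ℤ → Prop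
  | nil (p : ℤ × ℤ) : RoadPath D p p 0
  | cons {p q r : ℤ × ℤ} {c n : ℤ} :
      RoadStep D p q c → RoadPath D q r n → RoadPath D p r (c + n)

/-- The weighted distance on the lattice. -/
noncomputable def roadDist (D : ℤ → ℤ → Prop) (p q : ℤ × ℤ) : ℤ :=
  sInf {n : ℤ | RoadPath D p q n}

/-- The priority relation after exchanging rows and columns. -/
def transposed (D : ℤ → ℤ → Prop) : ℤ → ℤ → Prop := fun x y => ¬D y x

section roadDist

variable {D : ℤ → ℤ → Prop} {p q r : ℤ × ℤ} {c m n : ℤ}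

theorem RoadStep.symm (h : RoadStep D p q c) : RoadStep D q p c := by
  unfold RoadStep at *
  rw [abs_sub_comm q.1, abs_sub_comm q.2, or_comm (a := D q.1 q.2), or_comm (a := ¬D q.1 q.2),
    eq_comm (a := q.1), eq_comm (a := q.2)]
  exact h

theorem RoadStep.pos (h : RoadStep D p q c) : 1 ≤ c := by
  rcases h with ⟨-, -, ⟨-, h⟩ | ⟨-, h⟩⟩ | ⟨-, -, ⟨-, h⟩ | ⟨-, h⟩⟩ <;> omega

theorem RoadStep.swap (h : RoadStep D p q c) : RoadStep (transposed D) p.swap q.swap c := by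
  rcases h with ⟨h1, h2, h3⟩ | ⟨h1, h2, h3⟩
  · right
    refine ⟨h1, h2, ?_⟩
    simpa only [transposed, Prod.fst_swap, Prod.snd_swap, not_not] using h3
  · left
    refine ⟨h1, h2, ?_⟩
    simpa only [transposed, Prod.fst_swap, Prod.snd_swap, not_not] using h3

theorem RoadPath.nonneg (h : RoadPath D p q n) : 0 ≤ n := by
  induction h with
  | nil p => exact le_rfl
  | cons h1 _ ih => have := h1.pos; omega

theorem RoadPath.trans (h : RoadPath D p q n) (h' : RoadPath D q r m) :
    RoadPath D p r (n + m) := by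
  induction h with
  | nil p => simpa using h'
  | cons h1 _ ih => rw [add_assoc]; exact .cons h1 (ih h')

theorem RoadStep.path (h : RoadStep D p q c) : RoadPath D p q c := by
  simpa using RoadPath.cons h (.nil q)

theorem RoadPath.symm (h : RoadPath D p q n) : RoadPath D q p n := by
  induction h with
  | nil p => exact .nil p
  | cons h1 _ ih => rw [add_comm]; exact ih.trans h1.symm.path

theorem RoadPath.swap (h : RoadPath D p q n) : RoadPath (transposed D) p.swap q.swap n := by
  induction h with
  | nil p => exact .nil _
  | cons h1 _ ih => exact .cons h1.swap ih

theorem transposed_transposed (D : ℤ → ℤ → Prop) : transposed (transposed D) = D := by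
  funext x y
  simp [transposed]

theorem exists_roadStep_horizontal (D : ℤ → ℤ → Prop) {x x' : ℤ} (y : ℤ) (h : |x - x'| = 1) :
    ∃ c, RoadStep D (x, y) (x', y) c ∧ c ≤ 2 := by
  by_cases hD : D x y ∨ D x' y
  · exact ⟨2, Or.inl ⟨rfl, h, Or.inl ⟨hD, rfl⟩⟩, le_rfl⟩
  · exact ⟨1, Or.inl ⟨rfl, h, Or.inr ⟨hD, rfl⟩⟩, by norm_num⟩

theorem exists_roadPath_right (D : ℤ → ℤ → Prop) (x y : ℤ) (k : ℕ) :
    ∃ n, RoadPath D (x, y) (x + k, y) n ∧ n ≤ 2 * k := by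
  induction k with
  | zero => exact ⟨0, by simpa using RoadPath.nil (x, y), by simp⟩
  | succ k ih =>
    obtain ⟨n, hn, hn'⟩ := ih
    obtain ⟨c, hc, hc'⟩ := exists_roadStep_horizontal D (x := x + k) (x' := x + (k + 1 : ℕ)) y
      (by push_cast; rw [abs_sub_comm]; ring_nf; simp)
    exact ⟨n + c, hn.trans hc.path, by push_cast; omega⟩

theorem exists_roadPath_horizontal (D : ℤ → ℤ → Prop) (x x' y : ℤ) :
    ∃ n, RoadPath D (x, y) (x', y) n ∧ n ≤ 2 * |x - x'| := by
  rcases le_total x x' with h | h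
  · obtain ⟨n, hn, hn'⟩ := exists_roadPath_right D x y (x' - x).toNat
    rw [Int.toNat_of_nonneg (by omega)] at hn hn'
    refine ⟨n, by simpa using hn, ?_⟩
    rw [abs_sub_comm, abs_of_nonneg (by omega)]; exact hn'
  · obtain ⟨n, hn, hn'⟩ := exists_roadPath_right D x' y (x - x').toNat
    rw [Int.toNat_of_nonneg (by omega)] at hn hn'
    refine ⟨n, by simpa using hn.symm, ?_⟩
    rw [abs_of_nonneg (by omega)]; exact hn'

theorem exists_roadPath_vertical (D : ℤ → ℤ → Prop) (x y y' : ℤ) :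
    ∃ n, RoadPath D (x, y) (x, y') n ∧ n ≤ 2 * |y - y'| := by
  obtain ⟨n, hn, hn'⟩ := exists_roadPath_horizontal (transposed D) y y' x
  exact ⟨n, by simpa [transposed_transposed] using hn.swap, hn'⟩

theorem exists_roadPath (D : ℤ → ℤ → Prop) (p q : ℤ × ℤ) :
    ∃ n, RoadPath D p q n ∧ n ≤ 2 * (|p.1 - q.1| + |p.2 - q.2|) := by
  obtain ⟨n, hn, hn'⟩ := exists_roadPath_horizontal D p.1 q.1 p.2
  obtain ⟨m, hm, hm'⟩ := exists_roadPath_vertical D q.1 p.2 q.2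
  exact ⟨n + m, hn.trans hm, by omega⟩

theorem bddBelow_roadPath (D : ℤ → ℤ → Prop) (p q : ℤ × ℤ) :
    BddBelow {n : ℤ | RoadPath D p q n} :=
  ⟨0, fun _ h => RoadPath.nonneg h⟩

/-- The weights form a nonempty set of integers bounded below, so the infimum is attained and is not
a default value. -/
theorem roadPath_roadDist (D : ℤ → ℤ → Prop) (p q : ℤ × ℤ) :
    RoadPath D p q (roadDist D p q) := by
  obtain ⟨n, hn, -⟩ := exists_roadPath D p q
  exact Int.csInf_mem ⟨n, hn⟩ (bddBelow_roadPath D p q)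

theorem RoadPath.roadDist_le (h : RoadPath D p q n) : roadDist D p q ≤ n :=
  csInf_le (bddBelow_roadPath D p q) h

theorem roadDist_nonneg (D : ℤ → ℤ → Prop) (p q : ℤ × ℤ) : 0 ≤ roadDist D p q :=
  (roadPath_roadDist D p q).nonneg

theorem roadDist_comm (D : ℤ → ℤ → Prop) (p q : ℤ × ℤ) : roadDist D p q = roadDist D q p :=
  le_antisymm (roadPath_roadDist D q p).symm.roadDist_le (roadPath_roadDist D p q).symm.roadDist_le

theorem roadDist_self (D : ℤ → ℤ → Prop) (p : ℤ × ℤ) : roadDist D p p = 0 :=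
  le_antisymm (RoadPath.nil p).roadDist_le (roadDist_nonneg D p p)

theorem roadDist_triangle (D : ℤ → ℤ → Prop) (p q r : ℤ × ℤ) :
    roadDist D p r ≤ roadDist D p q + roadDist D q r :=
  ((roadPath_roadDist D p q).trans (roadPath_roadDist D q r)).roadDist_le

theorem roadDist_le_two_mul (D : ℤ → ℤ → Prop) (p q : ℤ × ℤ) :
    roadDist D p q ≤ 2 * (|p.1 - q.1| + |p.2 - q.2|) := by
  obtain ⟨n, hn, hn'⟩ := exists_roadPath D p q
  exact hn.roadDist_le.trans hn'

theorem roadDist_transposed (D : ℤ → ℤ → Prop) (p q : ℤ × ℤ) :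
    roadDist (transposed D) p.swap q.swap = roadDist D p q := by
  apply le_antisymm (roadPath_roadDist D p q).swap.roadDist_le
  have := (roadPath_roadDist (transposed D) p.swap q.swap).swap
  rw [transposed_transposed, Prod.swap_swap, Prod.swap_swap] at this
  exact this.roadDist_le

/-! ### Lower bounds by potentials, and exits of geodesics from regions. -/

/-- `f` changes by at most the weight along every edge with an endpoint in `A`. -/
def LipOn (D : ℤ → ℤ → Prop) (A : Set (ℤ × ℤ)) (f : ℤ × ℤ → ℤ) : Prop :=
  ∀ a ∈ A, ∀ b c, RoadStep D a b c → |f b - f a| ≤ c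

theorem LipOn.mono {A B : Set (ℤ × ℤ)} {f : ℤ × ℤ → ℤ} (h : LipOn D B f) (hAB : A ⊆ B) :
    LipOn D A f := fun a ha => h a (hAB ha)

theorem lipOn_swap {A : Set (ℤ × ℤ)} {f : ℤ × ℤ → ℤ}
    (h : LipOn (transposed D) (Prod.swap ⁻¹' A) f) : LipOn D A (f ∘ Prod.swap) :=
  fun a ha _ c hc => h a.swap (by simpa using ha) _ c hc.swap

/-- A geodesic from `w` to `u` leaves the set `A` at the vertex `P`. -/
structure ExitsAt (D : ℤ → ℤ → Prop) (A : Set (ℤ × ℤ)) (w u P : ℤ × ℤ) : Prop where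
  split : roadDist D w u = roadDist D w P + roadDist D P u
  lip : ∀ f, LipOn D A f → |f P - f w| ≤ roadDist D w P
  notMem : P ∉ A
  adj : ∃ a ∈ A, ∃ c, RoadStep D a P c

/-- Cut the path at its first vertex outside `A`. All edges before the cut start in `A`, so a
potential controlled only on `A` bounds the initial piece. -/
theorem RoadPath.exit {A : Set (ℤ × ℤ)} (h : RoadPath D p r n) (hp : p ∈ A) :
    (r ∈ A ∧ ∀ f, LipOn D A f → |f r - f p| ≤ n) ∨
    ∃ q m l, n = m + l ∧ RoadPath D p q m ∧ RoadPath D q r l ∧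
      (∀ f, LipOn D A f → |f q - f p| ≤ m) ∧ q ∉ A ∧ ∃ a ∈ A, ∃ c, RoadStep D a q c := by
  induction h with
  | nil p => exact Or.inl ⟨hp, fun f _ => by simp⟩
  | @cons p q r c n h1 h2 ih =>
    by_cases hq : q ∈ A
    · rcases ih hq with ⟨hr, hf⟩ | ⟨q', m, l, rfl, hm, hl, hf, hq', hadj⟩
      · refine Or.inl ⟨hr, fun f hlip => ?_⟩
        have h3 := hlip p hp q c h1
        have h4 := hf f hlip
        have := abs_sub_le (f r) (f q) (f p)
        omega
      · refine Or.inr ⟨q', c + m, l, by ring, .cons h1 hm, hl, fun f hlip => ?_, hq', hadj⟩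
        have h3 := hlip p hp q c h1
        have h4 := hf f hlip
        have := abs_sub_le (f q') (f q) (f p)
        omega
    · exact Or.inr ⟨q, c, n, rfl, h1.path, h2, fun f hlip => hlip p hp q c h1, hq, p, hp, c, h1⟩

theorem stays_or_exits {A : Set (ℤ × ℤ)} {w u : ℤ × ℤ} (hw : w ∈ A) :
    (u ∈ A ∧ ∀ f, LipOn D A f → |f u - f w| ≤ roadDist D w u) ∨ ∃ P, ExitsAt D A w u P := by
  rcases (roadPath_roadDist D w u).exit hw with h | ⟨q, m, l, h, hm, hl, hf, hq, hadj⟩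
  · exact Or.inl h
  · have h1 := hm.roadDist_le
    have h2 := hl.roadDist_le
    have h3 := roadDist_triangle D w q u
    have h4 : m = roadDist D w q := by omega
    exact Or.inr ⟨q, by omega, h4 ▸ hf, hq, hadj⟩

theorem exists_exitsAt {A : Set (ℤ × ℤ)} {w u : ℤ × ℤ} (hw : w ∈ A) (hu : u ∉ A) :
    ∃ P, ExitsAt D A w u P := by
  rcases stays_or_exits (D := D) (u := u) hw with h | h
  · exact absurd h.1 hu
  · exact h

theorem abs_sub_le_roadDist {f : ℤ × ℤ → ℤ} (hf : LipOn D Set.univ f) (p q : ℤ × ℤ) :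
    |f q - f p| ≤ roadDist D p q := by
  rcases stays_or_exits (D := D) (u := q) (Set.mem_univ p) with h | ⟨P, h⟩
  · exact h.2 f hf
  · exact absurd (Set.mem_univ P) h.notMem

theorem ExitsAt.swap {A : Set (ℤ × ℤ)} {w u P : ℤ × ℤ} (h : ExitsAt D A w u P) :
    ExitsAt (transposed D) (Prod.swap ⁻¹' A) w.swap u.swap P.swap where
  split := by simpa only [roadDist_transposed] using h.split
  lip f hf := by simpa [roadDist_transposed] using h.lip _ (lipOn_swap hf)
  notMem := by simpa using h.notMem
  adj := by
    obtain ⟨a, ha, c, hc⟩ := h.adj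
    exact ⟨a.swap, by simpa using ha, c, hc.swap⟩

/-- For nested regions both exits can be chosen on one geodesic, so that the distances along it add
up. -/
theorem ExitsAt.extend {A B : Set (ℤ × ℤ)} {w u P : ℤ × ℤ} (h : ExitsAt D A w u P) (hAB : A ⊆ B)
    (hu : u ∉ B) : ∃ P', ExitsAt D B w u P' ∧
      (P' = P ∨ ExitsAt D B P u P' ∧ P ∈ B ∧
        roadDist D w P' = roadDist D w P + roadDist D P P') := by
  by_cases hP : P ∈ B
  · obtain ⟨P', hP'⟩ := exists_exitsAt (D := D) hP hu
    have h1 := hP'.split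
    have h2 := h.split
    have h3 := roadDist_triangle D w P P'
    have h4 := roadDist_triangle D w P' u
    have h5 : roadDist D w P' = roadDist D w P + roadDist D P P' := by omega
    refine ⟨P', ⟨by omega, fun f hf => ?_, hP'.notMem, hP'.adj⟩, Or.inr ⟨hP', hP, h5⟩⟩
    have h6 := h.lip f (hf.mono hAB)
    have h7 := hP'.lip f hf
    have := abs_sub_le (f P') (f P) (f w)
    omega
  · obtain ⟨a, ha, hc⟩ := h.adj
    exact ⟨P, ⟨h.split, fun f hf => h.lip f (hf.mono hAB), hP, a, hAB ha, hc⟩, Or.inl rfl⟩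

/-- Functions of the form `g x + h y` whose increments respect the edge weights. -/
theorem lipOn_add {A : Set (ℤ × ℤ)} {g h : ℤ → ℤ}
    (hg : ∀ a ∈ A, ∀ x, |a.1 - x| = 1 →
      |g x - g a.1| ≤ 1 ∨ |g x - g a.1| ≤ 2 ∧ (D a.1 a.2 ∨ D x a.2))
    (hh : ∀ a ∈ A, ∀ y, |a.2 - y| = 1 →
      |h y - h a.2| ≤ 1 ∨ |h y - h a.2| ≤ 2 ∧ (¬D a.1 a.2 ∨ ¬D a.1 y)) :
    LipOn D A (fun p => g p.1 + h p.2) := by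
  rintro ⟨a1, a2⟩ ha ⟨b1, b2⟩ c (⟨h1, h2, h3⟩ | ⟨h1, h2, h3⟩)
  · dsimp only at *
    subst h1
    have h4 := hg _ ha _ h2
    rw [add_sub_add_right_eq_sub]
    rcases h3 with ⟨h3, rfl⟩ | ⟨h3, rfl⟩
    · rcases h4 with h4 | h4
      · exact h4.trans (by norm_num)
      · exact h4.1
    · rcases h4 with h4 | h4
      · exact h4
      · exact absurd h4.2 h3
  · dsimp only at *
    subst h1
    have h4 := hh _ ha _ h2
    rw [add_sub_add_left_eq_sub]
    rcases h3 with ⟨h3, rfl⟩ | ⟨h3, rfl⟩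
    · rcases h4 with h4 | h4
      · exact h4.trans (by norm_num)
      · exact h4.1
    · rcases h4 with h4 | h4
      · exact h4
      · exact absurd h4.2 h3

theorem abs_add_abs_le_roadDist (D : ℤ → ℤ → Prop) (p q : ℤ × ℤ) :
    |p.1 - q.1| + |p.2 - q.2| ≤ roadDist D p q := by
  have key : ∀ σ τ : ℤ, |σ| ≤ 1 → |τ| ≤ 1 →
      |(σ * q.1 + τ * q.2) - (σ * p.1 + τ * p.2)| ≤ roadDist D p q := by
    intro σ τ hσ hτ
    refine abs_sub_le_roadDist (f := fun r => σ * r.1 + τ * r.2)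
      (lipOn_add (g := fun x => σ * x) (h := fun x => τ * x) ?_ ?_) p q
    · intro a _ x hx
      left
      rw [← mul_sub, abs_mul, abs_sub_comm, hx]; simpa
    · intro a _ x hx
      left
      rw [← mul_sub, abs_mul, abs_sub_comm, hx]; simpa
  have h1 := le_of_abs_le (key 1 1 (by simp) (by simp))
  have h2 := le_of_abs_le (key 1 (-1) (by simp) (by simp))
  have h3 := le_of_abs_le (key (-1) 1 (by simp) (by simp))
  have h4 := le_of_abs_le (key (-1) (-1) (by simp) (by simp))
  rcases abs_cases (p.1 - q.1) with ⟨h5, -⟩ | ⟨h5, -⟩ <;>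
  rcases abs_cases (p.2 - q.2) with ⟨h6, -⟩ | ⟨h6, -⟩ <;> rw [h5, h6] <;> linarith

end roadDist

/-! ### Upper bounds along rows and columns. -/

section segments

variable {D : ℤ → ℤ → Prop}

theorem roadDist_row_le {g : ℤ → ℤ} {x x' y : ℤ} (hx : x ≤ x')
    (hg : ∀ z, x ≤ z → z < x' →
      2 ≤ g (z + 1) - g z ∨ ¬D z y ∧ ¬D (z + 1) y ∧ 1 ≤ g (z + 1) - g z) :
    roadDist D (x, y) (x', y) ≤ g x' - g x := by
  induction x', hx using Int.leInduction with
  | base => simp [roadDist_self]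
  | succ n hn ih =>
    have h1 := ih fun z hz hz' => hg z hz (by omega)
    have h2 := roadDist_triangle D (x, y) (n, y) (n + 1, y)
    have h3 : roadDist D (n, y) (n + 1, y) ≤ g (n + 1) - g n := by
      obtain h | ⟨ha, hb, h⟩ := hg n hn (by omega)
      · refine le_trans ?_ h
        have := roadDist_le_two_mul D (n, y) (n + 1, y)
        simpa using this
      · refine le_trans (RoadPath.roadDist_le (RoadStep.path ?_)) h
        exact Or.inl ⟨rfl, by simp, Or.inr ⟨by tauto, rfl⟩⟩
    omega

theorem roadDist_row_le_abs {x x' y : ℤ} (h : ∀ z ∈ Set.uIcc x x', ¬D z y) :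
    roadDist D (x, y) (x', y) ≤ |x - x'| := by
  rcases le_total x x' with hx | hx
  · rw [Set.uIcc_of_le hx] at h
    have := roadDist_row_le (D := D) (g := fun z => z) (y := y) hx fun z hz hz' =>
      Or.inr ⟨h z ⟨hz, by omega⟩, h _ ⟨by omega, by omega⟩, by simp⟩
    rw [abs_sub_comm, abs_of_nonneg (by omega)]; exact this
  · rw [Set.uIcc_of_ge hx] at h
    have := roadDist_row_le (D := D) (g := fun z => z) (y := y) hx fun z hz hz' =>
      Or.inr ⟨h z ⟨hz, by omega⟩, h _ ⟨by omega, by omega⟩, by simp⟩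
    rw [roadDist_comm, abs_of_nonneg (by omega)]; exact this

theorem roadDist_row_le_abs_add_one {x x' y : ℤ} (h : ∀ z ∈ Set.uIcc x x', z ≠ x → ¬D z y) :
    roadDist D (x, y) (x', y) ≤ |x - x'| + 1 := by
  rcases lt_trichotomy x x' with hx | rfl | hx
  · rw [Set.uIcc_of_le hx.le] at h
    have := roadDist_row_le (D := D) (g := fun z => z + if z = x then 0 else 1) (y := y) hx.le
      fun z hz hz' => by
        by_cases hzx : z = x
        · left; subst hzx; simp; omega
        · refine Or.inr ⟨h z ⟨hz, by omega⟩ hzx, h _ ⟨by omega, by omega⟩ (by omega), ?_⟩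
          simp only [hzx, if_false]; split_ifs <;> omega
    simp only [if_true, hx.ne', if_false] at this
    rw [abs_sub_comm, abs_of_nonneg (by omega)]; omega
  · simp [roadDist_self]
  · rw [Set.uIcc_of_ge hx.le] at h
    have := roadDist_row_le (D := D) (g := fun z => z + if z = x then 1 else 0) (y := y) hx.le
      fun z hz hz' => by
        by_cases hzx : z + 1 = x
        · left
          have : z ≠ x := by omega
          simp only [hzx, if_true, this, if_false]; omega
        · refine Or.inr ⟨h z ⟨hz, by omega⟩ (by omega), h _ ⟨by omega, by omega⟩ hzx, ?_⟩
          have : z ≠ x := by omega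
          simp only [hzx, this, if_false]; omega
    simp only [if_true, hx.ne, if_false] at this
    rw [roadDist_comm, abs_of_nonneg (by omega)]; omega

theorem ediv_add_one_of_dvd {t x : ℤ} (ht : 0 < t) (h : t ∣ x + 1) : (x + 1) / t = x / t + 1 := by
  obtain ⟨k, hk⟩ := h
  have hx : x = t * k - 1 := by omega
  have h1 : x / t < k := Int.ediv_lt_of_lt_mul ht (by rw [hx, mul_comm]; omega)
  have h2 : k - 1 ≤ x / t := (Int.le_ediv_iff_mul_le ht).2 (by rw [hx]; nlinarith)
  rw [hk, Int.mul_ediv_cancel_left _ ht.ne']; omega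

theorem ediv_add_one_of_not_dvd {t x : ℤ} (ht : 0 < t) (h : ¬t ∣ x + 1) :
    (x + 1) / t = x / t := by
  have h1 : x / t ≤ (x + 1) / t := Int.ediv_le_ediv ht (by omega)
  have h2 := Int.ediv_mul_le (x + 1) ht.ne'
  have h3 : (x + 1) / t * t ≠ x + 1 := fun h3 => h ⟨_, by rw [mul_comm]; exact h3.symm⟩
  have h4 : (x + 1) / t ≤ x / t := (Int.le_ediv_iff_mul_le ht).2 (by omega)
  omega

/-- Each multiple of `T` can slow down two edges, the one before and the one after it. The terms `z
/ T` and `(z - 1) / T` of the budget pay for one each, giving slope `1 + 2 / T`. -/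
theorem mul_roadDist_row_le {T x x' y : ℤ} (hT : 0 < T) (h : ∀ z, ¬T ∣ z → ¬D z y) :
    T * roadDist D (x, y) (x', y) ≤ (T + 2) * |x - x'| + 2 * T := by
  wlog hx : x ≤ x' generalizing x x'
  · rw [roadDist_comm, abs_sub_comm]; exact this (by omega)
  have h1 := roadDist_row_le (D := D) (g := fun z => z + z / T + (z - 1) / T) (y := y) hx
    fun z _ _ => by
      simp only [add_sub_cancel_right]
      have e : z - 1 + 1 = z := by ring
      by_cases h1 : T ∣ z + 1
      · have h2 := ediv_add_one_of_dvd hT h1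
        have h3 : (z - 1) / T ≤ z / T := Int.ediv_le_ediv hT (by omega)
        left; omega
      · have h2 := ediv_add_one_of_not_dvd hT h1
        by_cases h4 : T ∣ z
        · have h3 := ediv_add_one_of_dvd (x := z - 1) hT (by rwa [e])
          rw [e] at h3
          left; omega
        · have h3 := ediv_add_one_of_not_dvd (x := z - 1) hT (by rwa [e])
          rw [e] at h3
          exact Or.inr ⟨h _ h4, h _ h1, by omega⟩
  rw [abs_sub_comm, abs_of_nonneg (by omega)]
  have h2 := Int.mul_ediv_self_le (x := x') hT.ne'
  have h3 := Int.mul_ediv_self_le (x := x' - 1) hT.ne'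
  have h4 := Int.lt_mul_ediv_self_add (x := x) hT
  have h5 := Int.lt_mul_ediv_self_add (x := x - 1) hT
  have h6 := mul_le_mul_of_nonneg_left h1 hT.le
  nlinarith

theorem roadDist_col_le_abs {x y y' : ℤ} (h : ∀ z ∈ Set.uIcc y y', D x z) :
    roadDist D (x, y) (x, y') ≤ |y - y'| := by
  rw [← roadDist_transposed]
  exact roadDist_row_le_abs fun z hz => not_not.2 (h z hz)

theorem roadDist_col_le_abs_add_one {x y y' : ℤ} (h : ∀ z ∈ Set.uIcc y y', z ≠ y → D x z) :
    roadDist D (x, y) (x, y') ≤ |y - y'| + 1 := by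
  rw [← roadDist_transposed]
  exact roadDist_row_le_abs_add_one fun z hz hzy => not_not.2 (h z hz hzy)

/-- Going around the corner `(X, Y)`: only one of the two roads is slowed down there. -/
theorem roadDist_corner_le {X Y x y : ℤ} (hc : ∀ z ∈ Set.uIcc Y y, z ≠ Y → D X z)
    (hr : ∀ z ∈ Set.uIcc X x, z ≠ X → ¬D z Y) :
    roadDist D (X, y) (x, Y) ≤ |y - Y| + |X - x| + 1 := by
  have h1 := roadDist_triangle D (X, y) (X, Y) (x, Y)
  rw [roadDist_comm D (X, y) (X, Y)] at h1
  rw [abs_sub_comm y]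
  by_cases h : D X Y
  · have h2 := roadDist_col_le_abs (D := D) (x := X) (y := Y) (y' := y) fun z hz => by
      by_cases hzY : z = Y
      · rwa [hzY]
      · exact hc z hz hzY
    have h3 := roadDist_row_le_abs_add_one hr
    omega
  · have h2 := roadDist_row_le_abs (D := D) (y := Y) (x := X) (x' := x) fun z hz => by
      by_cases hzX : z = X
      · rwa [hzX]
      · exact hr z hz hzX
    have h3 := roadDist_col_le_abs_add_one hc
    omega

end segments

/-! ### Potentials that separate into a horizontal and a vertical part. -/

section potentials

variable {D : ℤ → ℤ → Prop}

/-- The increments of `g` respect the weights of the horizontal edges at `A`. -/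
def RowLip (D : ℤ → ℤ → Prop) (A : Set (ℤ × ℤ)) (g : ℤ → ℤ) : Prop :=
  ∀ a ∈ A, ∀ x, |a.1 - x| = 1 → |g x - g a.1| ≤ 1 ∨ |g x - g a.1| ≤ 2 ∧ (D a.1 a.2 ∨ D x a.2)

/-- The increments of `h` respect the weights of the vertical edges at `A`. -/
def ColLip (D : ℤ → ℤ → Prop) (A : Set (ℤ × ℤ)) (h : ℤ → ℤ) : Prop :=
  ∀ a ∈ A, ∀ y, |a.2 - y| = 1 → |h y - h a.2| ≤ 1 ∨ |h y - h a.2| ≤ 2 ∧ (¬D a.1 a.2 ∨ ¬D a.1 y)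

theorem rowLip_id (A : Set (ℤ × ℤ)) : RowLip D A id := fun a _ x hx =>
  Or.inl (by rw [abs_sub_comm]; exact hx.le)

theorem colLip_id (A : Set (ℤ × ℤ)) : ColLip D A id := fun a _ x hx =>
  Or.inl (by rw [abs_sub_comm]; exact hx.le)

theorem RowLip.neg {A : Set (ℤ × ℤ)} {g : ℤ → ℤ} (hg : RowLip D A g) :
    RowLip D A (fun x => -g x) := fun a ha x hx => by
  have := hg a ha x hx
  rwa [neg_sub_neg, abs_sub_comm]

theorem ColLip.neg {A : Set (ℤ × ℤ)} {g : ℤ → ℤ} (hg : ColLip D A g) :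
    ColLip D A (fun x => -g x) := fun a ha x hx => by
  have := hg a ha x hx
  rwa [neg_sub_neg, abs_sub_comm]

theorem abs_add_abs_le_of_lip {A : Set (ℤ × ℤ)} {g h : ℤ → ℤ} (hg : RowLip D A g)
    (hh : ColLip D A h) {P Q : ℤ × ℤ} {N : ℤ} (hN : ∀ f, LipOn D A f → |f Q - f P| ≤ N) :
    |g P.1 - g Q.1| + |h P.2 - h Q.2| ≤ N := by
  have h1 := le_of_abs_le (hN _ (lipOn_add hg hh))
  have h2 := le_of_abs_le (hN _ (lipOn_add hg.neg hh))
  have h3 := le_of_abs_le (hN _ (lipOn_add hg hh.neg))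
  have h4 := le_of_abs_le (hN _ (lipOn_add hg.neg hh.neg))
  rcases abs_cases (g P.1 - g Q.1) with ⟨h5, -⟩ | ⟨h5, -⟩ <;>
  rcases abs_cases (h P.2 - h Q.2) with ⟨h6, -⟩ | ⟨h6, -⟩ <;> rw [h5, h6] <;> linarith

/-- The distance to `X`, with a surcharge for the last step. -/
def stepPotential (X x : ℤ) : ℤ := |x - X| + if x = X then 0 else 1

theorem stepPotential_self (X : ℤ) : stepPotential X X = 0 := by simp [stepPotential]

theorem stepPotential_of_ne {X x : ℤ} (h : x ≠ X) : stepPotential X x = |x - X| + 1 := by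
  simp [stepPotential, h]

theorem stepPotential_increment {X x x' : ℤ} (h : |x - x'| = 1) :
    |stepPotential X x' - stepPotential X x| ≤ 1 ∨
      |stepPotential X x' - stepPotential X x| ≤ 2 ∧ (x = X ∨ x' = X) := by
  unfold stepPotential
  have h' : x - x' = 1 ∨ x - x' = -1 := by
    rcases abs_cases (x - x') with ⟨h1, -⟩ | ⟨h1, -⟩ <;> omega
  by_cases hx : x = X
  · subst hx
    right
    refine ⟨?_, Or.inl rfl⟩
    rw [abs_sub_comm x', h]
    split_ifs <;> simp
  · by_cases hx' : x' = X
    · subst hx'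
      right
      refine ⟨?_, Or.inr rfl⟩
      rw [h]
      split_ifs <;> simp
    · left
      rw [if_neg hx, if_neg hx']
      rcases abs_cases (x - X) with ⟨h1, h2⟩ | ⟨h1, h2⟩ <;>
      rcases abs_cases (x' - X) with ⟨h3, h4⟩ | ⟨h3, h4⟩ <;>
      rw [h1, h3, abs_le] <;> omega

end potentials

/-! ### Geodesics through cells. -/

/-- Two scales of the priority relation: rows divisible by `s` beat all columns which are not
divisible by `T`, all other rows are beaten by the columns divisible by `t`. -/
structure IsCell (D : ℤ → ℤ → Prop) (s t T : ℤ) : Prop where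
  s_pos : 0 < s
  t_pos : 0 < t
  T_eq : T = 16 * t
  beaten : ∀ x y, t ∣ x → ¬s ∣ y → D x y
  beats : ∀ x y, ¬T ∣ x → s ∣ y → ¬D x y

/-- The open horizontal strip of height `s` above the row `y₀`. -/
def openStrip (y₀ s : ℤ) : Set (ℤ × ℤ) := {p | y₀ < p.2 ∧ p.2 < y₀ + s}

/-- The open rectangle of size `T × s` with lower left corner `(x₀, y₀)`. -/
def openCell (x₀ y₀ T s : ℤ) : Set (ℤ × ℤ) :=
  {p | (x₀ < p.1 ∧ p.1 < x₀ + T) ∧ y₀ < p.2 ∧ p.2 < y₀ + s}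

theorem not_dvd_of_between {s y₀ y : ℤ} (h : s ∣ y₀) (h1 : y₀ < y) (h2 : y < y₀ + s) :
    ¬s ∣ y := by
  intro h3
  have h4 := Int.le_of_dvd (by omega) (dvd_sub h3 h)
  omega

namespace IsCell

variable {D : ℤ → ℤ → Prop} {s t T : ℤ} (hC : IsCell D s t T)

include hC

theorem T_pos : 0 < T := by have := hC.t_pos; have := hC.T_eq; omega

theorem t_dvd_T : t ∣ T := ⟨16, by rw [hC.T_eq, mul_comm]⟩

end IsCell

/-- Where column `X` has priority, the horizontal edges at it weigh 2, which pays for the surcharge.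
-/
theorem rowLip_stepPotential {D : ℤ → ℤ → Prop} {A : Set (ℤ × ℤ)} {X : ℤ}
    (h : ∀ a ∈ A, D X a.2) : RowLip D A (stepPotential X) := by
  intro a ha x hx
  refine (stepPotential_increment hx).imp_right fun ⟨h1, h2⟩ => ⟨h1, ?_⟩
  rcases h2 with h2 | h2
  · exact Or.inl (h2 ▸ h a ha)
  · exact Or.inr (h2 ▸ h a ha)

theorem colLip_stepPotential {D : ℤ → ℤ → Prop} {A : Set (ℤ × ℤ)} {Y : ℤ}
    (h : ∀ a ∈ A, ¬D a.1 Y) : ColLip D A (stepPotential Y) := by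
  intro a ha x hx
  refine (stepPotential_increment hx).imp_right fun ⟨h1, h2⟩ => ⟨h1, ?_⟩
  rcases h2 with h2 | h2
  · exact Or.inl (h2 ▸ h a ha)
  · exact Or.inr (h2 ▸ h a ha)

theorem rowLip_add_ediv {D : ℤ → ℤ → Prop} {A : Set (ℤ × ℤ)} {t : ℤ} (ht : 0 < t)
    (h : ∀ x, t ∣ x → ∀ a ∈ A, D x a.2) : RowLip D A (fun x => x + x / t) := by
  intro a ha x hx
  have key : ∀ z, (z + 1) / t - z / t = 0 ∨ (z + 1) / t - z / t = 1 ∧ D (z + 1) a.2 := by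
    intro z
    by_cases hz : t ∣ z + 1
    · right; exact ⟨by rw [ediv_add_one_of_dvd ht hz]; ring, h _ hz a ha⟩
    · left; rw [ediv_add_one_of_not_dvd ht hz]; ring
  dsimp only
  have h' : x = a.1 + 1 ∨ a.1 = x + 1 := by
    rcases abs_cases (a.1 - x) with ⟨h1, -⟩ | ⟨h1, -⟩ <;> omega
  rcases h' with h' | h'
  · rw [h']
    rcases key a.1 with h1 | ⟨h1, h2⟩
    · left; rw [abs_le]; omega
    · right; exact ⟨by rw [abs_le]; omega, Or.inr h2⟩
  · rw [h']
    rcases key x with h1 | ⟨h1, h2⟩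
    · left; rw [abs_le]; omega
    · right; exact ⟨by rw [abs_le]; omega, Or.inl h2⟩

/-- The function `x + ⌊x / t⌋` grows almost with slope `1 + 1 / t`. -/
theorem mul_abs_sub_le {t x x' : ℤ} (ht : 0 < t) :
    (t + 1) * |x - x'| - t ≤ t * |(x + x / t) - (x' + x' / t)| := by
  wlog hx : x ≤ x' generalizing x x'
  · rw [abs_sub_comm x, abs_sub_comm (x + x / t)]; exact this (by omega)
  have h1 := Int.mul_ediv_self_le (x := x) ht.ne'
  have h2 := Int.lt_mul_ediv_self_add (x := x') ht
  rw [abs_sub_comm, abs_of_nonneg (by omega)]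
  have h3 := mul_le_mul_of_nonneg_left (neg_abs_le ((x + x / t) - (x' + x' / t))) ht.le
  nlinarith

section cells

variable {D : ℤ → ℤ → Prop} {s t T : ℤ}

theorem openCell_boundary {x₀ y₀ : ℤ} {P : ℤ × ℤ} (hP : P ∉ openCell x₀ y₀ T s)
    (hadj : ∃ a ∈ openCell x₀ y₀ T s, ∃ c, RoadStep D a P c) :
    (P.1 = x₀ ∨ P.1 = x₀ + T) ∧ (y₀ < P.2 ∧ P.2 < y₀ + s) ∨
      (P.2 = y₀ ∨ P.2 = y₀ + s) ∧ (x₀ < P.1 ∧ P.1 < x₀ + T) := by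
  obtain ⟨a, ⟨⟨h1, h2⟩, h3, h4⟩, c, ⟨h5, h6, -⟩ | ⟨h5, h6, -⟩⟩ := hadj
  · left
    refine ⟨?_, by omega, by omega⟩
    have h7 : ¬(x₀ < P.1 ∧ P.1 < x₀ + T) := fun h => hP ⟨h, by omega, by omega⟩
    rcases abs_cases (a.1 - P.1) with ⟨h8, -⟩ | ⟨h8, -⟩ <;> omega
  · right
    refine ⟨?_, by omega, by omega⟩
    have h7 : ¬(y₀ < P.2 ∧ P.2 < y₀ + s) := fun h => hP ⟨⟨by omega, by omega⟩, h⟩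
    rcases abs_cases (a.2 - P.2) with ⟨h8, -⟩ | ⟨h8, -⟩ <;> omega

theorem openStrip_boundary {y₀ : ℤ} {P : ℤ × ℤ} (hP : P ∉ openStrip y₀ s)
    (hadj : ∃ a ∈ openStrip y₀ s, ∃ c, RoadStep D a P c) : P.2 = y₀ ∨ P.2 = y₀ + s := by
  obtain ⟨a, ⟨h3, h4⟩, c, ⟨h5, h6, -⟩ | ⟨h5, h6, -⟩⟩ := hadj
  · exact absurd (show P ∈ openStrip y₀ s from ⟨by omega, by omega⟩) hP
  · have h7 : ¬(y₀ < P.2 ∧ P.2 < y₀ + s) := fun h => hP h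
    rcases abs_cases (a.2 - P.2) with ⟨h8, -⟩ | ⟨h8, -⟩ <;> omega

theorem openCell_subset_openStrip (x₀ y₀ : ℤ) : openCell x₀ y₀ T s ⊆ openStrip y₀ s :=
  fun _ h => h.2

namespace IsCell

variable (hC : IsCell D s t T)

include hC

theorem beaten_of_T_dvd {x y : ℤ} (hx : T ∣ x) (hy : ¬s ∣ y) : D x y :=
  hC.beaten _ _ (hC.t_dvd_T.trans hx) hy

theorem rowLip_strip {y₀ : ℤ} (hy : s ∣ y₀) : RowLip D (openStrip y₀ s) (fun x => x + x / t) :=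
  rowLip_add_ediv hC.t_pos fun x hx _ ha => hC.beaten x _ hx (not_dvd_of_between hy ha.1 ha.2)

theorem rowLip_cell {x₀ y₀ X : ℤ} (hy : s ∣ y₀) (hX : T ∣ X) :
    RowLip D (openCell x₀ y₀ T s) (stepPotential X) :=
  rowLip_stepPotential fun _ ha => hC.beaten_of_T_dvd hX (not_dvd_of_between hy ha.2.1 ha.2.2)

theorem colLip_cell {x₀ y₀ Y : ℤ} (hx : T ∣ x₀) (hY : s ∣ Y) :
    ColLip D (openCell x₀ y₀ T s) (stepPotential Y) :=
  colLip_stepPotential fun _ ha => hC.beats _ _ (not_dvd_of_between hx ha.1.1 ha.1.2) hY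

/-- A geodesic does not leave a cell through a side next to the one through which it entered. -/
theorem not_adjacent {x₀ y₀ X Y : ℤ} (hx₀ : T ∣ x₀) (hy₀ : s ∣ y₀) (hX : X = x₀ ∨ X = x₀ + T)
    (hY : Y = y₀ ∨ Y = y₀ + s) {P Q : ℤ × ℤ} (hP1 : P.1 = X) (hP2 : y₀ < P.2 ∧ P.2 < y₀ + s)
    (hQ1 : x₀ < Q.1 ∧ Q.1 < x₀ + T) (hQ2 : Q.2 = Y)
    (hN : ∀ f, LipOn D (openCell x₀ y₀ T s) f → |f Q - f P| ≤ roadDist D P Q) : False := by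
  obtain ⟨P1, P2⟩ := P
  obtain ⟨Q1, Q2⟩ := Q
  dsimp only at *
  subst hP1 hQ2
  have hX' : T ∣ P1 := by rcases hX with rfl | rfl; exacts [hx₀, dvd_add hx₀ dvd_rfl]
  have hY' : s ∣ Q2 := by rcases hY with rfl | rfl; exacts [hy₀, dvd_add hy₀ dvd_rfl]
  -- Inside the cell both the departure from column `P1` and the arrival at row `Q2` cost an extra
  -- unit, whereas the route around the corner costs only one.
  have h1 := abs_add_abs_le_of_lip (hC.rowLip_cell (x₀ := x₀) hy₀ hX')
    (hC.colLip_cell (y₀ := y₀) hx₀ hY') hN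
  rw [stepPotential_self, stepPotential_self, stepPotential_of_ne (by omega),
    stepPotential_of_ne (by omega)] at h1
  have h2 := roadDist_corner_le (D := D) (X := P1) (Y := Q2) (x := Q1) (y := P2)
    (fun z hz hzY => hC.beaten_of_T_dvd hX' (not_dvd_of_between hy₀
      (by rw [Set.mem_uIcc] at hz; omega) (by rw [Set.mem_uIcc] at hz; omega)))
    (fun z hz hzX => hC.beats _ _ (not_dvd_of_between hx₀
      (by rw [Set.mem_uIcc] at hz; omega) (by rw [Set.mem_uIcc] at hz; omega)) hY')
  dsimp only at h1
  rw [zero_sub, abs_neg, sub_zero, abs_of_nonneg (a := |Q1 - P1| + 1) (by positivity),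
    abs_of_nonneg (a := |P2 - Q2| + 1) (by positivity), abs_sub_comm Q1] at h1
  omega

/-- A geodesic which crosses a cell horizontally does not leave the strip of the cell later. -/
theorem not_exit_strip {y₀ X X' Y : ℤ} (hy₀ : s ∣ y₀) (hX : T ∣ X) (hX' : X' = X + T ∨ X = X' + T)
    (hY : Y = y₀ ∨ Y = y₀ + s) {P Q R : ℤ × ℤ} (hP1 : P.1 = X) (hP2 : y₀ < P.2 ∧ P.2 < y₀ + s)
    (hQ1 : Q.1 = X') (hR2 : R.2 = Y)
    (hPQ : ∀ f, LipOn D (openStrip y₀ s) f → |f Q - f P| ≤ roadDist D P Q)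
    (hQR : ∀ f, LipOn D (openStrip y₀ s) f → |f R - f Q| ≤ roadDist D Q R)
    (hPR : roadDist D P R = roadDist D P Q + roadDist D Q R) : False := by
  obtain ⟨P1, P2⟩ := P
  obtain ⟨Q1, Q2⟩ := Q
  obtain ⟨R1, R2⟩ := R
  dsimp only at *
  subst hP1 hQ1 hR2
  have ht := hC.t_pos
  have hT := hC.T_eq
  have hY' : s ∣ R2 := by rcases hY with rfl | rfl; exacts [hy₀, dvd_add hy₀ dvd_rfl]
  have h1 := abs_add_abs_le_of_lip (hC.rowLip_strip hy₀) (colLip_id _) hPQ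
  have h2 := abs_add_abs_le_of_lip (hC.rowLip_strip hy₀) (colLip_id _) hQR
  have h3 := mul_abs_sub_le (x := Q1) (x' := R1) ht
  simp only [id] at h1 h2
  -- The crossing pays for `T / t = 16` slow columns. Over the same width the boundary row loses at
  -- most 4 and reaching it at most 1, and beyond `Q` its slope `1 + 2 / T` is below `1 + 1 / t`.
  have h4 : |(P1 + P1 / t) - (Q1 + Q1 / t)| = T + 16 := by
    obtain ⟨k, hk⟩ := hC.t_dvd_T.trans hX
    have e1 : P1 / t = k := by rw [hk, Int.mul_ediv_cancel_left _ ht.ne']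
    rcases hX' with h | h
    · have e2 : Q1 / t = k + 16 := by
        rw [h, hk, hT, show t * k + 16 * t = t * (k + 16) by ring,
          Int.mul_ediv_cancel_left _ ht.ne']
      rw [e1, e2, abs_sub_comm, abs_of_nonneg] <;> omega
    · have e2 : Q1 / t = k - 16 := by
        rw [show Q1 = P1 - T by omega, hk, hT, show t * k - 16 * t = t * (k - 16) by ring,
          Int.mul_ediv_cancel_left _ ht.ne']
      rw [e1, e2, abs_of_nonneg] <;> omega
  have h5 := roadDist_triangle D (P1, P2) (P1, R2) (R1, R2)
  have h6 := mul_roadDist_row_le (D := D) (x := P1) (x' := R1) (y := R2) hC.T_pos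
    fun z hz => hC.beats z _ hz hY'
  have h7 := roadDist_col_le_abs_add_one (D := D) (x := P1) (y := R2) (y' := P2)
    fun z hz hzY => hC.beaten_of_T_dvd hX (not_dvd_of_between hy₀
      (by rw [Set.mem_uIcc] at hz; omega) (by rw [Set.mem_uIcc] at hz; omega))
  rw [roadDist_comm D (P1, R2)] at h7
  have h8 : |P1 - R1| ≤ T + |Q1 - R1| := by
    have := abs_sub_le P1 Q1 R1
    have : |P1 - Q1| = T := by
      rcases hX' with h | h
      · rw [h, sub_add_cancel_left, abs_neg, abs_of_pos hC.T_pos]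
      · rw [h, add_sub_cancel_left, abs_of_pos hC.T_pos]
    omega
  have h9 : |R2 - P2| ≤ |P2 - Q2| + |Q2 - R2| := by
    rw [abs_sub_comm]; exact abs_sub_le _ _ _
  have h10 := abs_nonneg (Q1 - R1)
  rw [h4] at h1
  set z := |Q1 - R1|
  set w := |Q1 + Q1 / t - (R1 + R1 / t)|
  set e := |P1 - R1|
  set d := roadDist D (P1, R2) (R1, R2)
  have h11 : T + 16 + w ≤ 1 + d := by omega
  have h12 : (T + 2) * e ≤ (T + 2) * (T + z) := mul_le_mul_of_nonneg_left h8 (by omega)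
  have h13 := mul_le_mul_of_nonneg_left h11 hC.T_pos.le
  subst hT
  nlinarith

/-- A nearly horizontal geodesic is not much longer than its horizontal extent. -/
theorem roadDist_le_of_slope {u v : ℤ × ℤ} (huv : |u.2 - v.2| ≤ s)
    (h : (t + 1) * |u.1 - v.1| - t ≤ t * roadDist D u v) :
    roadDist D u v ≤ |u.1 - v.1| + 11 * s := by
  obtain ⟨u1, u2⟩ := u
  obtain ⟨v1, v2⟩ := v
  dsimp only at *
  have ht := hC.t_pos
  have hs := hC.s_pos
  have hT := hC.T_eq
  have h1 := Int.mul_ediv_self_le (x := u2) hs.ne'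
  have h2 := Int.lt_mul_ediv_self_add (x := u2) hs
  set y := s * (u2 / s) with hy
  have h3 := roadDist_triangle D (u1, u2) (u1, y) (v1, v2)
  have h4 := roadDist_triangle D (u1, y) (v1, y) (v1, v2)
  have h5 := roadDist_le_two_mul D (u1, u2) (u1, y)
  have h6 := roadDist_le_two_mul D (v1, y) (v1, v2)
  have h7 := mul_roadDist_row_le (D := D) (x := u1) (x' := v1) (y := y) hC.T_pos
    fun z hz => hC.beats z _ hz ⟨_, hy⟩
  simp only [sub_self, abs_zero, zero_add] at h5 h6
  have h8 : |u2 - y| ≤ s := by rw [abs_le]; omega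
  have h9 : |y - v2| ≤ 2 * s := by
    have := abs_sub_le y u2 v2
    rw [abs_sub_comm y u2] at this
    omega
  set d := roadDist D (u1, u2) (v1, v2)
  have h10 : T * d ≤ T * (6 * s) + (T + 2) * |u1 - v1| + 2 * T := by
    have : T * d ≤ T * (6 * s + roadDist D (u1, y) (v1, y)) :=
      mul_le_mul_of_nonneg_left (by omega) hC.T_pos.le
    linarith
  set X := |u1 - v1|
  subst hT
  have hst : t ≤ t * s := by nlinarith
  -- The row has slope `1 + 1 / (8 * t)` and the geodesic at least `1 + 1 / t`, up to constants. So
  -- the extent is `O(t * s)`, and the delays along the row are only `O(s)`.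
  have h11 : 14 * X ≤ 144 * (t * s) := by nlinarith
  have h12 : t * (16 * 7 * d) ≤ t * (16 * 7 * (X + 11 * s)) := by nlinarith
  have := le_of_mul_le_mul_left h12 ht
  omega

end IsCell

/-- The exits `P` and `Q` lie on sides of the cell. Equal or adjacent sides contradict minimality;
opposite vertical sides trap the whole geodesic in the strip and give the first alternative;
opposite horizontal sides are the second. -/
theorem IsCell.alternative (hC : IsCell D s t T) {x₀ y₀ : ℤ} (hx₀ : T ∣ x₀) (hy₀ : s ∣ y₀)
    {u v w P Q : ℤ × ℤ} (huv : roadDist D u v = roadDist D w u + roadDist D w v)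
    (hw : w ∈ openCell x₀ y₀ T s) (hP : ExitsAt D (openCell x₀ y₀ T s) w u P)
    (hQ : ExitsAt D (openCell x₀ y₀ T s) w v Q) :
    roadDist D u v ≤ |u.1 - v.1| + 11 * s ∨
      (P.2 = y₀ ∨ P.2 = y₀ + s) ∧ (Q.2 = y₀ ∨ Q.2 = y₀ + s) ∧ P.2 ≠ Q.2 ∧
      (x₀ < P.1 ∧ P.1 < x₀ + T) ∧ (x₀ < Q.1 ∧ Q.1 < x₀ + T) := by
  have e1 := hP.split
  have e2 := hQ.split
  have e3 := roadDist_triangle D u P v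
  have e4 := roadDist_triangle D P Q v
  have e5 := roadDist_triangle D P w Q
  have e6 := roadDist_comm D u P
  have e7 := roadDist_comm D P w
  have ePQ : roadDist D P Q = roadDist D w P + roadDist D w Q := by omega
  have hPQ : ∀ f, LipOn D (openCell x₀ y₀ T s) f → |f Q - f P| ≤ roadDist D P Q := by
    intro f hf
    have h1 := hP.lip f hf
    have h2 := hQ.lip f hf
    have h3 := abs_sub_le (f Q) (f w) (f P)
    rw [abs_sub_comm (f w)] at h3
    omega
  have hQP : ∀ f, LipOn D (openCell x₀ y₀ T s) f → |f P - f Q| ≤ roadDist D Q P := by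
    intro f hf
    rw [abs_sub_comm, roadDist_comm]; exact hPQ f hf
  have l1 := abs_add_abs_le_roadDist D w P
  have l2 := abs_add_abs_le_roadDist D w Q
  rcases openCell_boundary hP.notMem hP.adj with ⟨hP1, hP2⟩ | ⟨hP2, hP1⟩ <;>
  rcases openCell_boundary hQ.notMem hQ.adj with ⟨hQ1, hQ2⟩ | ⟨hQ2, hQ1⟩
  · by_cases hne : P.1 = Q.1
    -- Running along the common side has no delay and avoids the detour to `w`.
    · exfalso
      have hX : T ∣ P.1 := by
        rcases hP1 with h | h <;> rw [h]
        exacts [hx₀, dvd_add hx₀ dvd_rfl]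
      have h1 := roadDist_col_le_abs (D := D) (x := P.1) (y := P.2) (y' := Q.2)
        fun z hz => hC.beaten_of_T_dvd hX (not_dvd_of_between hy₀
          (by rw [Set.mem_uIcc] at hz; omega) (by rw [Set.mem_uIcc] at hz; omega))
      rw [show (P.1, Q.2) = Q from Prod.ext hne rfl] at h1
      change roadDist D P Q ≤ _ at h1
      have h2 := abs_sub_le P.2 w.2 Q.2
      rw [abs_sub_comm P.2 w.2] at h2
      have h3 : 0 < |w.1 - P.1| := abs_pos.2 (by have := hw.1; omega)
      have h4 := abs_nonneg (w.1 - Q.1)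
      omega
    · left
      have hX : T ∣ P.1 := by
        rcases hP1 with h | h <;> rw [h]
        exacts [hx₀, dvd_add hx₀ dvd_rfl]
      have hX' : T ∣ Q.1 := by
        rcases hQ1 with h | h <;> rw [h]
        exacts [hx₀, dvd_add hx₀ dvd_rfl]
      have hsub := openCell_subset_openStrip (s := s) (T := T) x₀ y₀
      rcases stays_or_exits (D := D) (A := openStrip y₀ s) (w := Q) (u := v) hQ2 with
        ⟨hv, hv'⟩ | ⟨R, hR⟩
      · rcases stays_or_exits (D := D) (A := openStrip y₀ s) (w := P) (u := u) hP2 with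
          ⟨hu, hu'⟩ | ⟨R, hR⟩
        · apply hC.roadDist_le_of_slope
          · rw [abs_le]
            obtain ⟨h1, h2⟩ := hv
            obtain ⟨h3, h4⟩ := hu
            omega
          · have h1 := abs_add_abs_le_of_lip (hC.rowLip_strip hy₀) (colLip_id _)
              (P := u) (Q := v) (N := roadDist D u v) (by
                intro f hf
                have h1 := hPQ f (hf.mono hsub)
                have h2 := hv' f hf
                have h3 := hu' f hf
                have h4 := abs_sub_le (f v) (f Q) (f u)
                have h5 := abs_sub_le (f Q) (f P) (f u)
                rw [abs_sub_comm (f P) (f u)] at h5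
                omega)
            have h2 := mul_abs_sub_le (x := u.1) (x' := v.1) hC.t_pos
            have h3 := abs_nonneg (id u.2 - id v.2)
            have h4 := mul_le_mul_of_nonneg_left (show |(u.1 + u.1 / t) - (v.1 + v.1 / t)| ≤
              roadDist D u v by omega) hC.t_pos.le
            omega
        · exfalso
          have f1 := roadDist_triangle D Q P R
          have f2 := roadDist_triangle D Q R u
          have f3 := roadDist_triangle D u Q v
          have f4 := hR.split
          have f5 := roadDist_comm D u Q
          have f6 := roadDist_comm D P Q
          exact hC.not_exit_strip hy₀ hX' (by omega) (openStrip_boundary hR.notMem hR.adj) rfl hQ2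
            (P := Q) (Q := P) (R := R) rfl rfl (fun f hf => hQP f (hf.mono hsub)) hR.lip (by omega)
      · exfalso
        have f1 := roadDist_triangle D P Q R
        have f2 := roadDist_triangle D P R v
        have f4 := hR.split
        exact hC.not_exit_strip hy₀ hX (by omega) (openStrip_boundary hR.notMem hR.adj) rfl hP2
          (Q := Q) (R := R) rfl rfl (fun f hf => hPQ f (hf.mono hsub)) hR.lip (by omega)
  · exact (hC.not_adjacent hx₀ hy₀ hP1 hQ2 rfl hP2 hQ1 rfl hPQ).elim
  · exact (hC.not_adjacent hx₀ hy₀ hQ1 hP2 rfl hQ2 hP1 rfl hQP).elim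
  · by_cases hne : P.2 = Q.2
    · exfalso
      have hY : s ∣ P.2 := by
        rcases hP2 with h | h <;> rw [h]
        exacts [hy₀, dvd_add hy₀ dvd_rfl]
      have h1 := roadDist_row_le_abs (D := D) (y := P.2) (x := P.1) (x' := Q.1)
        fun z hz => hC.beats _ _ (not_dvd_of_between hx₀
          (by rw [Set.mem_uIcc] at hz; omega) (by rw [Set.mem_uIcc] at hz; omega)) hY
      rw [show (Q.1, P.2) = Q from Prod.ext rfl hne] at h1
      change roadDist D P Q ≤ _ at h1
      have h2 := abs_sub_le P.1 w.1 Q.1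
      rw [abs_sub_comm P.1 w.1] at h2
      have h3 : 0 < |w.2 - P.2| := abs_pos.2 (by have := hw.2; omega)
      have h4 := abs_nonneg (w.2 - Q.2)
      omega
    · exact Or.inr ⟨hP2, hQ2, hne, hP1, hQ1⟩

end cells

/-! ### The hierarchical priority and its cells. -/

/-- The priority relation of the hierarchical road grid: column `x` beats row `y` if `x` is
divisible by all powers of `16` that divide `y`. -/
def Priority (x y : ℤ) : Prop := ∀ i : ℕ, (16 : ℤ) ^ i ∣ y → (16 : ℤ) ^ i ∣ x

theorem priority_of_dvd {j : ℕ} {x y : ℤ} (hx : (16 : ℤ) ^ j ∣ x) (hy : ¬(16 : ℤ) ^ (j + 1) ∣ y) :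
    Priority x y := by
  intro i hi
  have hij : i ≤ j := by
    by_contra h
    exact hy ((pow_dvd_pow _ (by omega)).trans hi)
  exact (pow_dvd_pow _ hij).trans hx

theorem not_priority_of_dvd {j : ℕ} {x y : ℤ} (hx : ¬(16 : ℤ) ^ j ∣ x) (hy : (16 : ℤ) ^ j ∣ y) :
    ¬Priority x y := fun h => hx (h j hy)

theorem isCell_square (j : ℕ) :
    IsCell Priority (16 ^ (j + 1)) (16 ^ j) (16 ^ (j + 1)) where
  s_pos := by positivity
  t_pos := by positivity
  T_eq := by ring
  beaten _ _ hx hy := priority_of_dvd hx hy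
  beats _ _ hx hy := not_priority_of_dvd hx hy

/-- Ties favour the column: a column divisible by `16 ^ j` is beaten only by rows divisible by `16 ^
(j + 1)`. Hence exchanging the axes gives cells of width `16 ^ j` and height `16 ^ (j + 1)` instead
of squares. -/
theorem isCell_tall (j : ℕ) :
    IsCell (transposed Priority) (16 ^ j) (16 ^ j) (16 ^ (j + 1)) where
  s_pos := by positivity
  t_pos := by positivity
  T_eq := by ring
  beaten _ _ hx hy := not_priority_of_dvd hy hx
  beats _ _ hx hy := not_not.2 (priority_of_dvd hy hx)

theorem swap_preimage_openCell (x₀ y₀ T s : ℤ) :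
    Prod.swap ⁻¹' openCell x₀ y₀ T s = openCell y₀ x₀ s T := by
  ext ⟨a, b⟩
  simp [openCell, and_comm]

theorem exists_dvd_lt {s x : ℤ} (hs : 0 < s) (hx : ¬s ∣ x) :
    ∃ x₀, s ∣ x₀ ∧ x₀ < x ∧ x < x₀ + s := by
  refine ⟨s * (x / s), dvd_mul_right _ _, ?_, Int.lt_mul_ediv_self_add hs⟩
  exact lt_of_le_of_ne (Int.mul_ediv_self_le hs.ne') fun h => hx ⟨_, h.symm⟩

/-- A geodesic does not cross a square cell vertically within a horizontal crossing of the tall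
cell around it. -/
theorem not_cross_both {j : ℕ} {x₀ y₀ Y₀ : ℤ} (hx₀ : (16 : ℤ) ^ j ∣ x₀) (hy₀ : (16 : ℤ) ^ j ∣ y₀)
    (hY₀ : (16 : ℤ) ^ (j + 1) ∣ Y₀) {P Q P' Q' : ℤ × ℤ}
    (hP2 : P.2 = y₀ ∨ P.2 = y₀ + 16 ^ j)
    (hP1 : x₀ < P.1 ∧ P.1 < x₀ + 16 ^ j)
    (hPQ : |P.1 - Q.1| + |P.2 - Q.2| + 2 ≤ roadDist Priority P Q)
    (hP1' : P'.1 = x₀ ∨ P'.1 = x₀ + 16 ^ j) (hQ1' : Q'.1 = x₀ ∨ Q'.1 = x₀ + 16 ^ j)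
    (hne' : P'.1 ≠ Q'.1) (hP2' : Y₀ < P'.2 ∧ P'.2 < Y₀ + 16 ^ (j + 1))
    (hQ2' : Y₀ < Q'.2 ∧ Q'.2 < Y₀ + 16 ^ (j + 1))
    (hP : P ∈ openCell x₀ Y₀ (16 ^ j) (16 ^ (j + 1)))
    (hPP : |P.1 - P'.1| + 1 + |P.2 - P'.2| ≤ roadDist Priority P P')
    (hsum : roadDist Priority P' Q' =
      roadDist Priority P P' + roadDist Priority P Q + roadDist Priority Q Q') : False := by
  have hY := hP.2
  have hPY : (16 : ℤ) ^ j ∣ P.2 := by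
    rcases hP2 with h | h <;> rw [h]
    exacts [hy₀, dvd_add hy₀ dvd_rfl]
  have hX : (16 : ℤ) ^ j ∣ P'.1 := by
    rcases hP1' with h | h <;> rw [h]
    exacts [hx₀, dvd_add hx₀ dvd_rfl]
  have hX' : (16 : ℤ) ^ j ∣ Q'.1 := by
    rcases hQ1' with h | h <;> rw [h]
    exacts [hx₀, dvd_add hx₀ dvd_rfl]
  have l1 := abs_add_abs_le_roadDist Priority Q Q'
  have c1 := roadDist_col_le_abs (D := Priority) (x := P'.1) (y := P'.2) (y' := P.2)
    fun z hz => priority_of_dvd hX (not_dvd_of_between hY₀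
      (by rw [Set.mem_uIcc] at hz; omega) (by rw [Set.mem_uIcc] at hz; omega))
  have c2 := roadDist_col_le_abs (D := Priority) (x := Q'.1) (y := P.2) (y' := Q'.2)
    fun z hz => priority_of_dvd hX' (not_dvd_of_between hY₀
      (by rw [Set.mem_uIcc] at hz; omega) (by rw [Set.mem_uIcc] at hz; omega))
  -- The competing route uses both vertical sides and row `P.2`. It has total delay at most 2,
  -- against 3 forced by `hPQ` and `hPP`.
  have r1 := roadDist_row_le_abs_add_one (D := Priority) (y := P.2) (x := P'.1) (x' := P.1)
    fun z hz hzx => not_priority_of_dvd (not_dvd_of_between hx₀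
      (by rw [Set.mem_uIcc] at hz; omega) (by rw [Set.mem_uIcc] at hz; omega)) hPY
  have r2 := roadDist_row_le_abs_add_one (D := Priority) (y := P.2) (x := Q'.1) (x' := P.1)
    fun z hz hzx => not_priority_of_dvd (not_dvd_of_between hx₀
      (by rw [Set.mem_uIcc] at hz; omega) (by rw [Set.mem_uIcc] at hz; omega)) hPY
  rw [roadDist_comm] at r2
  have t1 := roadDist_triangle Priority P' (P'.1, P.2) Q'
  have t2 := roadDist_triangle Priority (P'.1, P.2) (P.1, P.2) Q'
  have t3 := roadDist_triangle Priority (P.1, P.2) (Q'.1, P.2) Q'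
  change roadDist Priority P' _ ≤ _ at c1
  change roadDist Priority _ Q' ≤ _ at c2
  have a1 := abs_sub_le P.2 Q.2 Q'.2
  have a2 : |P'.1 - P.1| + |Q'.1 - P.1| = 16 ^ j := by
    rcases abs_cases (P'.1 - P.1) with ⟨h, _⟩ | ⟨h, _⟩ <;>
    rcases abs_cases (Q'.1 - P.1) with ⟨h', _⟩ | ⟨h', _⟩ <;> omega
  have a3 := abs_sub_le P.1 Q.1 Q'.1
  rw [abs_sub_comm P'.1] at a2 r1
  rw [abs_sub_comm Q'.1] at a2 r2
  rw [abs_sub_comm P'.2] at c1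
  omega

/-- Far from its endpoints, a geodesic follows the lines divisible by `16 ^ j`, unless the two
endpoints are almost on a common horizontal or vertical line. -/
theorem dvd_or_dvd_of_geodesic {j : ℕ} {u v w : ℤ × ℤ}
    (huv : roadDist Priority u v = roadDist Priority w u + roadDist Priority w v)
    (hu : 40 * 16 ^ (j + 1) ≤ roadDist Priority w u)
    (hv : 40 * 16 ^ (j + 1) ≤ roadDist Priority w v)
    (h1 : ¬(16 : ℤ) ^ (j + 1) ∣ w.1) (h2 : ¬(16 : ℤ) ^ (j + 1) ∣ w.2) :
    roadDist Priority u v ≤ |u.1 - v.1| + 11 * 16 ^ (j + 1) ∨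
      roadDist Priority u v ≤ |u.2 - v.2| + 11 * 16 ^ (j + 1) := by
  by_contra! hcon
  have hsq := isCell_square j
  -- With index `j + 1` the tall cell is as wide as the square one, so it can contain it.
  have htall := isCell_tall (j + 1)
  obtain ⟨x₀, hx₀, hx1, hx2⟩ := exists_dvd_lt hsq.s_pos h1
  obtain ⟨y₀, hy₀, hy1, hy2⟩ := exists_dvd_lt hsq.s_pos h2
  have h2' : ¬(16 : ℤ) ^ (j + 1 + 1) ∣ w.2 := fun h => h2 ((pow_dvd_pow _ (by omega)).trans h)
  obtain ⟨Y₀, hY₀, hY1, hY2⟩ := exists_dvd_lt htall.T_pos h2'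
  have hpow : (16 : ℤ) ^ (j + 1 + 1) = 16 * 16 ^ (j + 1) := by ring
  have hYdvd : (16 : ℤ) ^ (j + 1) ∣ Y₀ := (pow_dvd_pow _ (by omega)).trans hY₀
  have hYy : Y₀ ≤ y₀ ∧ y₀ + 16 ^ (j + 1) ≤ Y₀ + 16 ^ (j + 1 + 1) := by
    constructor
    · have := (Int.le_of_dvd · (dvd_sub hYdvd hy₀))
      by_contra hlt
      have := this (by omega)
      omega
    · have hd : (16 : ℤ) ^ (j + 1) ∣ y₀ - (Y₀ + 16 ^ (j + 1 + 1)) :=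
        dvd_sub hy₀ (dvd_add hYdvd (pow_dvd_pow _ (by omega)))
      by_contra hlt
      have hd' : (16 : ℤ) ^ (j + 1) ∣ Y₀ + 16 ^ (j + 1 + 1) - y₀ := by
        rw [← dvd_neg, neg_sub]; exact hd
      have := Int.le_of_dvd (by omega) hd'
      omega
  set s : ℤ := 16 ^ (j + 1) with hs
  have hsub : openCell x₀ y₀ s s ⊆ openCell x₀ Y₀ s (16 ^ (j + 1 + 1)) := by
    rintro ⟨a, b⟩ ⟨ha, hb⟩
    exact ⟨ha, by dsimp only at *; omega, by dsimp only at *; omega⟩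
  have hw : w ∈ openCell x₀ y₀ s s := ⟨⟨hx1, hx2⟩, hy1, hy2⟩
  -- Two points of the tall cell are at distance at most `2 * (s + 16 * s) = 34 * s`.
  have hfar : ∀ r, 40 * s ≤ roadDist Priority w r →
      r ∉ openCell x₀ Y₀ s (16 ^ (j + 1 + 1)) := by
    rintro r hr ⟨⟨h3, h4⟩, h5, h6⟩
    have h7 := roadDist_le_two_mul Priority w r
    have h8 : |w.1 - r.1| ≤ s := by rw [abs_le]; omega
    have h9 : |w.2 - r.2| ≤ 16 * s := by rw [abs_le]; omega
    have := hsq.s_pos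
    omega
  obtain ⟨P, hP⟩ := exists_exitsAt (D := Priority) hw fun h => hfar u hu (hsub h)
  obtain ⟨Q, hQ⟩ := exists_exitsAt (D := Priority) hw fun h => hfar v hv (hsub h)
  obtain ⟨P', hP', hPP⟩ := hP.extend hsub (hfar u hu)
  obtain ⟨Q', hQ', hQQ⟩ := hQ.extend hsub (hfar v hv)
  have e1 := hP.split
  have e2 := hQ.split
  have e1' := hP'.split
  have e2' := hQ'.split
  have e3 := roadDist_triangle Priority u P v
  have e4 := roadDist_triangle Priority P Q v
  have e3' := roadDist_triangle Priority u P' v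
  have e4' := roadDist_triangle Priority P' Q' v
  have e5 := roadDist_triangle Priority P w Q
  have e5' := roadDist_triangle Priority P' w Q'
  have e6 := roadDist_comm Priority u P
  have e6' := roadDist_comm Priority u P'
  have e7 := roadDist_comm Priority P w
  have e7' := roadDist_comm Priority P' w
  rcases hsq.alternative hx₀ hy₀ huv hw hP hQ with h | ⟨hP2, hQ2, hne, hP1, hQ1⟩
  · exact absurd h (not_le.2 hcon.1)
  have hPs := hP'.swap
  have hQs := hQ'.swap
  rw [swap_preimage_openCell] at hPs hQs
  rcases htall.alternative hY₀ hx₀ (u := u.swap) (v := v.swap) (w := w.swap)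
      (by simpa only [roadDist_transposed] using huv)
      (by rw [← swap_preimage_openCell]; simpa using hsub hw) hPs hQs with
    h | ⟨hP1', hQ1', hne', hP2', hQ2'⟩
  · rw [roadDist_transposed] at h
    exact absurd h (not_le.2 hcon.2)
  simp only [Prod.fst_swap, Prod.snd_swap] at hP1' hQ1' hne' hP2' hQ2'
  rcases hPP with rfl | ⟨hPP, hPmem, hPsum⟩
  · omega
  rcases hQQ with rfl | ⟨-, -, hQsum⟩
  · omega
  have hPX : (16 : ℤ) ^ (j + 1) ∣ P'.1 := by
    rcases hP1' with h | h <;> rw [h]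
    exacts [hx₀, dvd_add hx₀ dvd_rfl]
  have b1 := abs_add_abs_le_of_lip
    (rowLip_stepPotential (X := P'.1) (A := openCell x₀ Y₀ s (16 ^ (j + 1 + 1))) fun a ha =>
      priority_of_dvd hPX (not_dvd_of_between hY₀ ha.2.1 ha.2.2)) (colLip_id _) hPP.lip
  rw [stepPotential_self, stepPotential_of_ne (by omega), sub_zero,
    abs_of_nonneg (a := |P.1 - P'.1| + 1) (by positivity)] at b1
  have b2 := abs_add_abs_le_of_lip (P := w) (Q := P) (rowLip_id _)
    (hsq.colLip_cell (y₀ := y₀) hx₀ (Y := P.2)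
      (by rcases hP2 with h | h <;> rw [h]; exacts [hy₀, dvd_add hy₀ dvd_rfl])) hP.lip
  have b3 := abs_add_abs_le_of_lip (P := w) (Q := Q) (rowLip_id _)
    (hsq.colLip_cell (y₀ := y₀) hx₀ (Y := Q.2)
      (by rcases hQ2 with h | h <;> rw [h]; exacts [hy₀, dvd_add hy₀ dvd_rfl])) hQ.lip
  rw [stepPotential_self, stepPotential_of_ne (by omega), sub_zero,
    abs_of_nonneg (a := _ + 1) (by positivity)] at b2 b3
  have a1 := abs_sub_le P.1 w.1 Q.1
  have a2 := abs_sub_le P.2 w.2 Q.2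
  rw [abs_sub_comm P.1 w.1] at a1
  rw [abs_sub_comm P.2 w.2] at a2
  simp only [id] at b1 b2 b3
  exact not_cross_both (Q := Q) (Q' := Q') hx₀ hy₀ hY₀ hP2 hP1 (by omega) hP1' hQ1' hne' hP2' hQ2' hPmem b1
    (by omega)

/-- A geodesic through an interior point of a segment of a fast row passes through an endpoint of
the segment. -/
theorem exists_corner_of_dvd_snd {D : ℤ → ℤ → Prop} {s : ℤ} (hs : 2 ≤ s)
    (hbeats : ∀ x y, ¬s ∣ x → s ∣ y → ¬D x y) {w u : ℤ × ℤ} (h2 : s ∣ w.2) (h1 : ¬s ∣ w.1)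
    (hu : 2 * s ≤ roadDist D w u)
    (hline : ∀ P, roadDist D w u = roadDist D w P + roadDist D P u → |P.1 - w.1| < s →
      |P.2 - w.2| ≤ 1 → s ∣ P.1 ∨ s ∣ P.2) :
    ∃ c, s ∣ c ∧ |c - w.1| < s ∧
      roadDist D w u = roadDist D w (c, w.2) + roadDist D (c, w.2) u ∧
      (roadDist D w (c, w.2) = |c - w.1| ∨ roadDist D w (c, w.2) = |c - w.1| + 1) := by
  obtain ⟨x₀, hx₀, hx1, hx2⟩ := exists_dvd_lt (by omega) h1
  obtain ⟨P, hP⟩ := exists_exitsAt (D := D) (A := {p | (x₀ < p.1 ∧ p.1 < x₀ + s) ∧ p.2 = w.2})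
    (w := w) (u := u) ⟨⟨hx1, hx2⟩, rfl⟩ (by
      rintro ⟨⟨h3, h4⟩, h5⟩
      have h6 := roadDist_le_two_mul D w u
      rw [h5, sub_self, abs_zero] at h6
      have : |w.1 - u.1| < s := by rw [abs_lt]; omega
      omega)
  obtain ⟨a, ⟨⟨h3, h4⟩, h5⟩, c, ⟨h6, h7, -⟩ | ⟨h6, h7, -⟩⟩ := hP.adj
  · have h8 : ¬(x₀ < P.1 ∧ P.1 < x₀ + s) := fun h => hP.notMem ⟨h, by omega⟩
    have h9 : P.1 = x₀ ∨ P.1 = x₀ + s := by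
      rcases abs_cases (a.1 - P.1) with ⟨h10, -⟩ | ⟨h10, -⟩ <;> omega
    have hPw : P = (P.1, w.2) := Prod.ext rfl (by dsimp only; omega)
    refine ⟨P.1, ?_, ?_, hPw ▸ hP.split, ?_⟩
    · rcases h9 with h | h <;> rw [h]
      exacts [hx₀, dvd_add hx₀ dvd_rfl]
    · rw [abs_lt]; omega
    · have l1 := abs_add_abs_le_roadDist D w (P.1, w.2)
      have l2 := roadDist_row_le_abs_add_one (D := D) (x := P.1) (x' := w.1) (y := w.2)
        fun z hz hzx => hbeats _ _ (not_dvd_of_between hx₀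
          (by rw [Set.mem_uIcc] at hz; omega) (by rw [Set.mem_uIcc] at hz; omega)) h2
      rw [roadDist_comm] at l2
      change roadDist D w _ ≤ _ at l2
      dsimp only at l1
      rw [sub_self, abs_zero, abs_sub_comm] at l1
      omega
  -- Leaving the row vertically would put the geodesic on a vertex of no grid line.
  · exfalso
    have h8 := hline P hP.split (by rw [abs_lt]; omega) (by rw [abs_sub_comm, ← h5]; exact h7.le)
    rcases h8 with h8 | h8
    · exact not_dvd_of_between hx₀ (by omega) (by omega) h8
    · rw [← h5] at h2
      have h9 : s ∣ |a.2 - P.2| := (dvd_abs _ _).2 (dvd_sub h2 h8)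
      rw [h7] at h9
      have := Int.le_of_dvd one_pos h9
      omega

/-! ### Counting the slices of the road grid. -/

/-- The points at a given distance of `u` on the grid lines next to the corner `(s a, s b)`. -/
noncomputable def nearCorner (s : ℤ) (u : ℤ × ℤ) (k : ℤ) (i : (ℤ × ℤ) × (ℤ × ℤ) × ℤ) : ℤ × ℤ :=
  (s * i.1.1 + (k - roadDist Priority u (s * i.1.1, s * i.1.2) - i.2.2) * i.2.1.1,
    s * i.1.2 + (k - roadDist Priority u (s * i.1.1, s * i.1.2) - i.2.2) * i.2.1.2)

/-- Going back from `w` towards `u`, the geodesic follows its grid line to a corner. The distance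
from `u` to that corner then fixes the distance from the corner to `w`, up to the delay `ε`. For `j
= 0` every vertex is a corner. -/
theorem exists_eq_nearCorner {j : ℕ} {u v w : ℤ × ℤ}
    (huv : roadDist Priority u v = roadDist Priority u w + roadDist Priority w v)
    (hj : j = 0 ∨ (|u.1 - v.1| + 11 * 16 ^ j < roadDist Priority u v ∧
      |u.2 - v.2| + 11 * 16 ^ j < roadDist Priority u v) ∧
      50 * 16 ^ j ≤ roadDist Priority u w ∧ 50 * 16 ^ j ≤ roadDist Priority w v) :
    ∃ a b e f ε : ℤ, |16 ^ j * a - w.1| ≤ 16 ^ j ∧ |16 ^ j * b - w.2| ≤ 16 ^ j ∧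
      |e| ≤ 1 ∧ |f| ≤ 1 ∧ 0 ≤ ε ∧ ε ≤ 1 ∧
      w = nearCorner (16 ^ j) u (roadDist Priority u w) ((a, b), (e, f), ε) := by
  have hs : (0 : ℤ) < 16 ^ j := by positivity
  by_cases h12 : (16 : ℤ) ^ j ∣ w.1 ∧ (16 : ℤ) ^ j ∣ w.2
  · obtain ⟨⟨a, ha⟩, b, hb⟩ := h12
    refine ⟨a, b, 0, 0, 0, ?_, ?_, by simp, by simp, le_rfl, by simp, ?_⟩
    · rw [← ha, sub_self, abs_zero]; exact hs.le
    · rw [← hb, sub_self, abs_zero]; exact hs.le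
    · simp only [nearCorner, mul_zero, add_zero]
      exact Prod.ext ha hb
  rcases hj with rfl | ⟨hE, hfu, hfv⟩
  · simp at h12
  obtain _ | j := j
  · simp at h12
  have hs2 : (2 : ℤ) ≤ 16 ^ (j + 1) := by
    have : (0 : ℤ) < 16 ^ j := by positivity
    rw [pow_succ]; omega
  -- The margin 50 in place of 40 lets the line property hold also for points of the geodesic near
  -- `w`.
  have hline : ∀ P, roadDist Priority w u = roadDist Priority w P + roadDist Priority P u →
      roadDist Priority w P ≤ 4 * 16 ^ (j + 1) →
      (16 : ℤ) ^ (j + 1) ∣ P.1 ∨ (16 : ℤ) ^ (j + 1) ∣ P.2 := by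
    intro P hP hwP
    by_contra! h
    have t1 := roadDist_triangle Priority u P v
    have t2 := roadDist_triangle Priority P w v
    have t3 := roadDist_comm Priority u P
    have t4 := roadDist_comm Priority u w
    have t5 := roadDist_comm Priority w P
    have t6 := roadDist_triangle Priority w P v
    rcases dvd_or_dvd_of_geodesic (j := j) (u := u) (v := v) (w := P) (by omega) (by omega)
      (by omega) h.1 h.2 with h3 | h3 <;> omega
  have hwu := roadDist_comm Priority w u
  have hsplit : ∀ C c, roadDist Priority w u = roadDist Priority w C + roadDist Priority C u →
      (roadDist Priority w C = c ∨ roadDist Priority w C = c + 1) →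
      ∃ ε, 0 ≤ ε ∧ ε ≤ 1 ∧ c = roadDist Priority u w - roadDist Priority u C - ε := by
    intro C c h1 h2
    have := roadDist_comm Priority C u
    rcases h2 with h2 | h2
    · exact ⟨0, le_rfl, by simp, by omega⟩
    · exact ⟨1, by simp, le_rfl, by omega⟩
  have hsign : ∀ x y : ℤ, ∃ e : ℤ, |e| ≤ 1 ∧ y = x + |x - y| * e := by
    intro x y
    rcases abs_cases (x - y) with ⟨h, -⟩ | ⟨h, -⟩
    · exact ⟨-1, by simp, by rw [h]; ring⟩
    · exact ⟨1, by simp, by rw [h]; ring⟩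
  by_cases h2 : (16 : ℤ) ^ (j + 1) ∣ w.2
  · have h1 : ¬(16 : ℤ) ^ (j + 1) ∣ w.1 := fun h => h12 ⟨h, h2⟩
    obtain ⟨c, ⟨a, hca⟩, hc, hcs, hcd⟩ := exists_corner_of_dvd_snd (D := Priority) (w := w) (u := u)
      hs2 (fun x y hx hy => not_priority_of_dvd hx hy) h2 h1 (by omega)
      (fun P hP h3 h4 => hline P hP (by
        have := roadDist_le_two_mul Priority w P
        rw [abs_sub_comm w.1, abs_sub_comm w.2] at this
        omega))
    obtain ⟨b, hb⟩ := h2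
    obtain ⟨ε, h3, h4, h5⟩ := hsplit _ _ hcs hcd
    obtain ⟨e, he, he'⟩ := hsign c w.1
    refine ⟨a, b, e, 0, ε, ?_, ?_, he, by simp, h3, h4, ?_⟩
    · rw [← hca]; exact hc.le
    · rw [← hb, sub_self, abs_zero]; exact hs.le
    · refine Prod.ext ?_ ?_
      · simp only [nearCorner]
        rw [← hca, ← hb, ← h5]; exact he'
      · simp only [nearCorner, mul_zero, add_zero]; exact hb
  · have h1 : (16 : ℤ) ^ (j + 1) ∣ w.1 := by
      refine (hline w (by rw [roadDist_self, zero_add]) ?_).resolve_right h2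
      rw [roadDist_self]; positivity
    obtain ⟨c, ⟨b, hcb⟩, hc, hcs, hcd⟩ := exists_corner_of_dvd_snd (D := transposed Priority)
      (w := w.swap) (u := u.swap) hs2
      (fun x y hx hy => not_not.2 (priority_of_dvd hy
        fun h => hx ((pow_dvd_pow _ (by omega)).trans h))) h1 h2
      (by rw [roadDist_transposed]; omega)
      (fun P hP h3 h4 => by
        rw [← P.swap_swap] at hP
        simp only [roadDist_transposed] at hP
        simp only [Prod.fst_swap, Prod.snd_swap] at h3 h4
        refine (hline P.swap hP ?_).symm
        have := roadDist_le_two_mul Priority w P.swap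
        simp only [Prod.fst_swap, Prod.snd_swap] at this
        rw [abs_sub_comm w.1, abs_sub_comm w.2] at this
        omega)
    rw [show ((c, w.swap.2) : ℤ × ℤ) = Prod.swap (w.1, c) from rfl] at hcs hcd
    simp only [roadDist_transposed, Prod.fst_swap] at hcs hcd hc
    obtain ⟨a, ha⟩ := h1
    obtain ⟨ε, h3, h4, h5⟩ := hsplit _ _ hcs hcd
    obtain ⟨e, he, he'⟩ := hsign c w.2
    refine ⟨a, b, 0, e, ε, ?_, ?_, by simp, he, h3, h4, ?_⟩
    · rw [← ha, sub_self, abs_zero]; exact hs.le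
    · rw [← hcb]; exact hc.le
    · refine Prod.ext ?_ ?_
      · simp only [nearCorner, mul_zero, add_zero]; exact ha
      · simp only [nearCorner]
        rw [← hcb, ← ha, ← h5]; exact he'

/-- On an almost axis-parallel geodesic nearly all of the length is progress along that axis, so `k`
determines the position up to `O(S)`. In the other cases `w` is close to an endpoint. -/
theorem exists_slice_box {S : ℤ} {u v : ℤ × ℤ} {k : ℤ}
    (h : (roadDist Priority u v ≤ |u.1 - v.1| + 11 * S ∨
        roadDist Priority u v ≤ |u.2 - v.2| + 11 * S) ∨
      k < 50 * S ∨ roadDist Priority u v - k < 50 * S) :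
    ∃ z : ℤ × ℤ, ∀ w, roadDist Priority u w = k →
      roadDist Priority u v = roadDist Priority u w + roadDist Priority w v →
      |w.1 - z.1| ≤ 50 * S ∧ |w.2 - z.2| ≤ 50 * S := by
  have key : ∃ z : ℤ × ℤ, ∀ w, roadDist Priority u w = k →
      roadDist Priority u v = roadDist Priority u w + roadDist Priority w v →
      |u.1 - w.1| + |u.2 - w.2| ≤ k → |w.1 - v.1| + |w.2 - v.2| ≤ roadDist Priority u v - k →
      |w.1 - z.1| ≤ 50 * S ∧ |w.2 - z.2| ≤ 50 * S := by
    rcases h with (h | h) | h | h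
    · rcases le_total u.1 v.1 with huv | huv
      · refine ⟨(u.1 + k, u.2), fun w _ _ h1 h2 => ?_⟩
        have := abs_nonneg (w.2 - v.2)
        simp only [abs_le]
        rcases abs_cases (u.1 - v.1) with ⟨_, _⟩ | ⟨_, _⟩ <;>
        rcases abs_cases (u.1 - w.1) with ⟨_, _⟩ | ⟨_, _⟩ <;>
        rcases abs_cases (w.1 - v.1) with ⟨_, _⟩ | ⟨_, _⟩ <;>
        rcases abs_cases (u.2 - w.2) with ⟨_, _⟩ | ⟨_, _⟩ <;> omega
      · refine ⟨(u.1 - k, u.2), fun w _ _ h1 h2 => ?_⟩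
        have := abs_nonneg (w.2 - v.2)
        simp only [abs_le]
        rcases abs_cases (u.1 - v.1) with ⟨_, _⟩ | ⟨_, _⟩ <;>
        rcases abs_cases (u.1 - w.1) with ⟨_, _⟩ | ⟨_, _⟩ <;>
        rcases abs_cases (w.1 - v.1) with ⟨_, _⟩ | ⟨_, _⟩ <;>
        rcases abs_cases (u.2 - w.2) with ⟨_, _⟩ | ⟨_, _⟩ <;> omega
    · rcases le_total u.2 v.2 with huv | huv
      · refine ⟨(u.1, u.2 + k), fun w _ _ h1 h2 => ?_⟩
        have := abs_nonneg (w.1 - v.1)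
        simp only [abs_le]
        rcases abs_cases (u.2 - v.2) with ⟨_, _⟩ | ⟨_, _⟩ <;>
        rcases abs_cases (u.1 - w.1) with ⟨_, _⟩ | ⟨_, _⟩ <;>
        rcases abs_cases (w.2 - v.2) with ⟨_, _⟩ | ⟨_, _⟩ <;>
        rcases abs_cases (u.2 - w.2) with ⟨_, _⟩ | ⟨_, _⟩ <;> omega
      · refine ⟨(u.1, u.2 - k), fun w _ _ h1 h2 => ?_⟩
        have := abs_nonneg (w.1 - v.1)
        simp only [abs_le]
        rcases abs_cases (u.2 - v.2) with ⟨_, _⟩ | ⟨_, _⟩ <;>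
        rcases abs_cases (u.1 - w.1) with ⟨_, _⟩ | ⟨_, _⟩ <;>
        rcases abs_cases (w.2 - v.2) with ⟨_, _⟩ | ⟨_, _⟩ <;>
        rcases abs_cases (u.2 - w.2) with ⟨_, _⟩ | ⟨_, _⟩ <;> omega
    · refine ⟨u, fun w _ _ h1 h2 => ?_⟩
      rw [abs_sub_comm w.1, abs_sub_comm w.2]
      have := abs_nonneg (u.1 - w.1)
      have := abs_nonneg (u.2 - w.2)
      omega
    · refine ⟨v, fun w _ _ h1 h2 => ?_⟩
      have := abs_nonneg (w.1 - v.1)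
      have := abs_nonneg (w.2 - v.2)
      omega
  obtain ⟨z, hz⟩ := key
  refine ⟨z, fun w h1 h2 => hz w h1 h2 ?_ ?_⟩
  · rw [← h1]; exact abs_add_abs_le_roadDist _ _ _
  · have := abs_add_abs_le_roadDist Priority w v
    omega

theorem exists_slice_finset : ∃ B : ℕ, ∀ (u v : ℤ × ℤ) (k : ℤ), ∃ S : Finset (ℤ × ℤ),
    S.card ≤ B ∧ ∀ w, roadDist Priority u w = k →
      roadDist Priority u v = roadDist Priority u w + roadDist Priority w v → w ∈ S := by
  classical
  -- The box has radius `50 * 16 = 800` in units of `16 ^ j`; the distance to the corner and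
  -- rounding add 1 each, so each corner index takes `2 * 802 + 1` values. The other factors count
  -- `e`, `f` and `ε`.
  refine ⟨(1605 * 1605) * ((3 * 3) * 2), fun u v k => ?_⟩
  have hex : ∃ j : ℕ, (roadDist Priority u v ≤ |u.1 - v.1| + 11 * 16 ^ (j + 1) ∨
      roadDist Priority u v ≤ |u.2 - v.2| + 11 * 16 ^ (j + 1)) ∨
      k < 50 * 16 ^ (j + 1) ∨ roadDist Priority u v - k < 50 * 16 ^ (j + 1) := by
    refine ⟨k.toNat, Or.inr (Or.inl ?_)⟩
    have h1 : k.toNat < 16 ^ k.toNat := Nat.lt_pow_self (by norm_num)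
    have h2 : (k.toNat : ℤ) < 16 ^ k.toNat := by exact_mod_cast h1
    rw [pow_succ]
    have := Int.self_le_toNat k
    omega
  obtain ⟨z, hz⟩ := exists_slice_box (Nat.find_spec hex)
  -- Minimality makes the box conditions fail one scale lower, which is what `exists_eq_nearCorner`
  -- needs at scale `16 ^ j`.
  have hmin := fun i => Nat.find_min hex (m := i)
  set j := Nat.find hex
  set s : ℤ := 16 ^ j with hs
  have hs0 : 0 < s := by positivity
  rw [pow_succ, ← hs] at hz
  let I : ℤ → Finset ℤ := fun x => Finset.Icc (x / s - 802) (x / s + 802)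
  refine ⟨((I z.1 ×ˢ I z.2) ×ˢ (Finset.Icc (-1) 1 ×ˢ Finset.Icc (-1) 1) ×ˢ Finset.Icc 0 1).image
    (nearCorner s u k), ?_, fun w h1 h2 => ?_⟩
  · refine Finset.card_image_le.trans (le_of_eq ?_)
    have hI : ∀ x, (I x).card = 1605 := fun x => by
      simp only [I, Int.card_Icc]; omega
    simp only [Finset.card_product, hI]
    rfl
  · obtain ⟨a, b, e, f, ε, ha, hb, he, hf, h0, h1', hw⟩ := exists_eq_nearCorner (j := j) h2 (by
      rcases Nat.eq_zero_or_pos j with hj | hj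
      · exact Or.inl hj
      · right
        have := hmin (j - 1) (by omega)
        rw [Nat.sub_add_cancel hj] at this
        push Not at this
        refine ⟨this.1, by omega, by omega⟩)
    rw [h1, ← hs] at hw
    rw [← hs] at ha hb
    have hI : ∀ x y c : ℤ, |s * c - x| ≤ s → |x - y| ≤ 50 * (s * 16) → c ∈ I y := by
      intro x y c h3 h4
      have h5 := Int.mul_ediv_self_le (x := y) hs0.ne'
      have h6 := Int.lt_mul_ediv_self_add (x := y) hs0
      rw [abs_le] at h3 h4
      simp only [I, Finset.mem_Icc]
      constructor
      · have : s * (y / s - 802) ≤ s * c := by nlinarith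
        exact le_of_mul_le_mul_left this hs0
      · have : s * c ≤ s * (y / s + 802) := by nlinarith
        exact le_of_mul_le_mul_left this hs0
    obtain ⟨hz1, hz2⟩ := hz w h1 h2
    rw [Finset.mem_image]
    refine ⟨_, ?_, hw.symm⟩
    simp only [Finset.mem_product, Finset.mem_Icc]
    exact ⟨⟨hI _ _ _ ha hz1, hI _ _ _ hb hz2⟩, ⟨abs_le.1 he, abs_le.1 hf⟩, h0, h1'⟩

/-! ### Realising the weights by a graph. -/

/-- The `ℓ¹`-distance. -/
def taxicab (u v : ℤ × ℤ) : ℤ := |u.1 - v.1| + |u.2 - v.2|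

theorem taxicab_comm (u v : ℤ × ℤ) : taxicab u v = taxicab v u := by
  unfold taxicab
  rw [abs_sub_comm u.1, abs_sub_comm u.2]

theorem taxicab_triangle (u v w : ℤ × ℤ) : taxicab u w ≤ taxicab u v + taxicab v w := by
  unfold taxicab
  have := abs_sub_le u.1 v.1 w.1
  have := abs_sub_le u.2 v.2 w.2
  omega

theorem taxicab_self (u : ℤ × ℤ) : taxicab u u = 0 := by simp [taxicab]

theorem exists_squareLattice_walk (n : ℕ) : ∀ u v : ℤ × ℤ, taxicab u v ≤ n →
    ∃ p : squareLattice.Walk u v, p.length ≤ n := by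
  induction n with
  | zero =>
    intro u v h
    have : u = v := by
      unfold taxicab at h
      have h1 := abs_nonneg (u.1 - v.1)
      have h2 := abs_nonneg (u.2 - v.2)
      push_cast at h
      have h3 := abs_eq_zero.1 (show |u.1 - v.1| = 0 by omega)
      have h4 := abs_eq_zero.1 (show |u.2 - v.2| = 0 by omega)
      exact Prod.ext (by omega) (by omega)
    subst this
    exact ⟨.nil, le_rfl⟩
  | succ n ih =>
    intro u v h
    by_cases huv : u = v
    · subst huv
      exact ⟨.nil, by simp⟩
    have key : ∃ w, squareLattice.Adj u w ∧ taxicab w v ≤ n := by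
      unfold taxicab at *
      push_cast at h
      by_cases h1 : u.1 = v.1
      · have h2 : u.2 ≠ v.2 := fun h2 => huv (Prod.ext h1 h2)
        rcases lt_or_gt_of_ne h2 with h2 | h2
        · refine ⟨(u.1, u.2 + 1), by simp [squareLattice], ?_⟩
          rw [abs_of_neg (a := u.2 - v.2) (by omega)] at h
          rw [abs_of_nonpos (a := (u.1, u.2 + 1).2 - v.2) (by dsimp only; omega)]
          dsimp only; omega
        · refine ⟨(u.1, u.2 - 1), by simp [squareLattice], ?_⟩
          rw [abs_of_pos (a := u.2 - v.2) (by omega)] at h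
          rw [abs_of_nonneg (a := (u.1, u.2 - 1).2 - v.2) (by dsimp only; omega)]
          dsimp only; omega
      · rcases lt_or_gt_of_ne h1 with h2 | h2
        · refine ⟨(u.1 + 1, u.2), by simp [squareLattice], ?_⟩
          rw [abs_of_neg (a := u.1 - v.1) (by omega)] at h
          rw [abs_of_nonpos (a := (u.1 + 1, u.2).1 - v.1) (by dsimp only; omega)]
          dsimp only; omega
        · refine ⟨(u.1 - 1, u.2), by simp [squareLattice], ?_⟩
          rw [abs_of_pos (a := u.1 - v.1) (by omega)] at h
          rw [abs_of_nonneg (a := (u.1 - 1, u.2).1 - v.1) (by dsimp only; omega)]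
          dsimp only; omega
    obtain ⟨w, hw, hwv⟩ := key
    obtain ⟨p, hp⟩ := ih w v hwv
    exact ⟨.cons hw p, by simpa using hp⟩

/-- The vertex of the square lattice that carries the crossing `p` of the road grid. -/
def crossing (p : ℤ × ℤ) : ℤ × ℤ := (2 * p.1, 2 * p.2)

theorem taxicab_crossing (p q : ℤ × ℤ) : taxicab (crossing p) (crossing q) = 2 * taxicab p q := by
  unfold taxicab crossing
  dsimp only
  rw [← mul_sub, ← mul_sub, abs_mul, abs_mul, abs_two]
  ring

theorem RoadStep.taxicab_eq_one {D : ℤ → ℤ → Prop} {p q : ℤ × ℤ} {c : ℤ} (h : RoadStep D p q c) :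
    taxicab p q = 1 := by
  unfold taxicab
  rcases h with ⟨h1, h2, -⟩ | ⟨h1, h2, -⟩ <;> rw [h1, h2] <;> simp

/-- The square lattice together with a chord along every road of weight `1`. -/
def roadGraph : SimpleGraph (ℤ × ℤ) where
  Adj u v := squareLattice.Adj u v ∨
    ∃ p q, u = crossing p ∧ v = crossing q ∧ RoadStep Priority p q 1
  symm := ⟨fun _ _ h => h.imp (fun h => h.symm) fun ⟨p, q, hp, hq, h⟩ => ⟨q, p, hq, hp, h.symm⟩⟩
  loopless := ⟨fun u h => by
    rcases h with h | ⟨p, q, hp, hq, h⟩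
    · exact squareLattice.loopless.irrefl u h
    · have h1 := taxicab_crossing p q
      rw [← hp, ← hq, taxicab_self, h.taxicab_eq_one] at h1
      omega⟩

theorem squareLattice_le_roadGraph : squareLattice ≤ roadGraph := fun _ _ h => Or.inl h

theorem isBoundedExtension_roadGraph : roadGraph.IsBoundedExtension squareLattice := by
  refine ⟨squareLattice_le_roadGraph, 2, fun u v h => ?_⟩
  have huv : taxicab u v ≤ (2 : ℕ) := by
    rcases h with h | ⟨p, q, rfl, rfl, h⟩
    · have : taxicab u v = 1 := h
      rw [this]; norm_num
    · rw [taxicab_crossing, h.taxicab_eq_one]; norm_num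
  obtain ⟨p, hp⟩ := exists_squareLattice_walk 2 u v huv
  exact (SimpleGraph.Walk.edist_le p).trans (by exact_mod_cast hp)

theorem dist_roadGraph_le_taxicab (u v : ℤ × ℤ) : (roadGraph.dist u v : ℤ) ≤ taxicab u v := by
  have h0 : 0 ≤ taxicab u v := by unfold taxicab; positivity
  obtain ⟨p, hp⟩ := exists_squareLattice_walk (taxicab u v).toNat u v (Int.self_le_toNat _)
  have h1 := SimpleGraph.dist_le (p.mapLe squareLattice_le_roadGraph)
  rw [SimpleGraph.Walk.length_mapLe] at h1
  omega

theorem connected_roadGraph : roadGraph.Connected := by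
  refine ⟨fun u v => ?_⟩
  obtain ⟨p, -⟩ := exists_squareLattice_walk (taxicab u v).toNat u v (Int.self_le_toNat _)
  exact ⟨p.mapLe squareLattice_le_roadGraph⟩

theorem dist_crossing_le {p q : ℤ × ℤ} {n : ℤ} (h : RoadPath Priority p q n) :
    (roadGraph.dist (crossing p) (crossing q) : ℤ) ≤ n := by
  induction h with
  | nil p => simp
  | @cons p q r c n h1 _ ih =>
    have h2 : (roadGraph.dist (crossing p) (crossing q) : ℤ) ≤ c := by
      have h3 := h1.pos
      rcases h3.eq_or_lt with rfl | h3
      · have : roadGraph.Adj (crossing p) (crossing q) := Or.inr ⟨p, q, rfl, rfl, h1⟩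
        rw [SimpleGraph.dist_eq_one_iff_adj.2 this]; simp
      · have h4 := dist_roadGraph_le_taxicab (crossing p) (crossing q)
        rw [taxicab_crossing, h1.taxicab_eq_one] at h4
        omega
    have h3 := connected_roadGraph.dist_triangle (u := crossing p) (v := crossing q)
      (w := crossing r)
    omega

theorem dist_crossing_le_roadDist (p q : ℤ × ℤ) :
    (roadGraph.dist (crossing p) (crossing q) : ℤ) ≤ roadDist Priority p q :=
  dist_crossing_le (roadPath_roadDist _ p q)

/-- Every walk in the road graph is at least as long as a lattice path or as a road trip with
lattice paths at both ends. -/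
theorem taxicab_le_or_exists_roadTrip {u v : ℤ × ℤ} (w : roadGraph.Walk u v) :
    taxicab u v ≤ w.length ∨ ∃ p q, taxicab u (crossing p) + roadDist Priority p q +
      taxicab (crossing q) v ≤ w.length := by
  induction w with
  | nil => left; simp [taxicab_self]
  | @cons u u' v h w ih =>
    simp only [SimpleGraph.Walk.length_cons, Nat.cast_add, Nat.cast_one]
    rcases h with h | ⟨p₀, q₀, rfl, rfl, h⟩
    · have h1 : taxicab u u' = 1 := h
      rcases ih with ih | ⟨p, q, ih⟩
      · left
        have := taxicab_triangle u u' v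
        omega
      · right
        refine ⟨p, q, ?_⟩
        have := taxicab_triangle u u' (crossing p)
        omega
    · right
      have h1 := h.path.roadDist_le
      rcases ih with ih | ⟨p, q, ih⟩
      · exact ⟨p₀, q₀, by rw [taxicab_self]; omega⟩
      · refine ⟨p₀, q, ?_⟩
        rw [taxicab_self]
        rw [taxicab_crossing] at ih
        -- A lattice stretch between two crossings can be replaced by roads: the dilation doubles
        -- the lattice distance, and road edges weigh at most 2.
        have h2 : roadDist Priority q₀ p ≤ 2 * taxicab q₀ p := roadDist_le_two_mul _ _ _
        have h3 := roadDist_triangle Priority p₀ q₀ q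
        have h4 := roadDist_triangle Priority q₀ p q
        omega

theorem taxicab_le_or_exists_dist_eq (u v : ℤ × ℤ) :
    taxicab u v ≤ roadGraph.dist u v ∨ ∃ p q, (roadGraph.dist u v : ℤ) =
      taxicab u (crossing p) + roadDist Priority p q + taxicab (crossing q) v := by
  obtain ⟨w, hw⟩ := connected_roadGraph.exists_walk_length_eq_dist u v
  rcases taxicab_le_or_exists_roadTrip w with h | ⟨p, q, h⟩
  · left; rwa [hw] at h
  · right
    refine ⟨p, q, le_antisymm ?_ (hw ▸ h)⟩
    have h1 := connected_roadGraph.dist_triangle (u := u) (v := crossing p) (w := v)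
    have h2 := connected_roadGraph.dist_triangle (u := crossing p) (v := crossing q) (w := v)
    have h3 := dist_roadGraph_le_taxicab u (crossing p)
    have h4 := dist_roadGraph_le_taxicab (crossing q) v
    have h5 := dist_crossing_le_roadDist p q
    omega

/-- Use a row and a column divisible by 16, with at most two delays per 16 steps; access at both
ends costs a constant. -/
theorem mul_roadDist_le_taxicab (p q : ℤ × ℤ) :
    16 * roadDist Priority p q ≤ 18 * taxicab p q + 1664 := by
  obtain ⟨p1, p2⟩ := p
  obtain ⟨q1, q2⟩ := q
  have h1 := Int.mul_ediv_self_le (x := p2) (k := 16) (by norm_num)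
  have h2 := Int.lt_mul_ediv_self_add (x := p2) (k := 16) (by norm_num)
  have h3 := Int.mul_ediv_self_le (x := q1) (k := 16) (by norm_num)
  have h4 := Int.lt_mul_ediv_self_add (x := q1) (k := 16) (by norm_num)
  set y := 16 * (p2 / 16) with hy
  set x := 16 * (q1 / 16) with hx
  have e1 := roadDist_le_two_mul Priority (p1, p2) (p1, y)
  have e2 := mul_roadDist_row_le (D := Priority) (T := 16) (x := p1) (x' := x) (y := y)
    (by norm_num) fun z hz => not_priority_of_dvd (j := 1) (by simpa using hz)
      (by simpa using ⟨_, hy⟩)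
  have e3 := mul_roadDist_row_le (D := transposed Priority) (T := 16) (x := y) (x' := q2) (y := x)
    (by norm_num) fun z hz => not_not.2 (priority_of_dvd (j := 1) (by simpa using ⟨_, hx⟩)
      fun h => hz ((Dvd.intro 16 (by norm_num)).trans h))
  have e4 := roadDist_le_two_mul Priority (x, q2) (q1, q2)
  change 16 * roadDist _ (Prod.swap (x, y)) (Prod.swap (x, q2)) ≤ _ at e3
  rw [roadDist_transposed] at e3
  have t1 := roadDist_triangle Priority (p1, p2) (p1, y) (q1, q2)
  have t2 := roadDist_triangle Priority (p1, y) (x, y) (q1, q2)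
  have t3 := roadDist_triangle Priority (x, y) (x, q2) (q1, q2)
  simp only [sub_self, abs_zero, zero_add, add_zero] at e1 e4
  have a1 : |p2 - y| ≤ 16 := by rw [abs_le]; omega
  have a2 : |x - q1| ≤ 16 := by rw [abs_le]; omega
  have a3 := abs_sub_le p1 q1 x
  have a4 := abs_sub_le y p2 q2
  rw [abs_sub_comm q1 x] at a3
  rw [abs_sub_comm y p2] at a4
  unfold taxicab
  dsimp only
  omega

theorem exists_crossing_near (u : ℤ × ℤ) : ∃ p, taxicab u (crossing p) ≤ 2 := by
  refine ⟨(u.1 / 2, u.2 / 2), ?_⟩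
  unfold taxicab crossing
  dsimp only
  have h1 : |u.1 - 2 * (u.1 / 2)| ≤ 1 := by rw [abs_le]; omega
  have h2 : |u.2 - 2 * (u.2 / 2)| ≤ 1 := by rw [abs_le]; omega
  omega

theorem mul_dist_roadGraph_le (u v : ℤ × ℤ) :
    16 * (roadGraph.dist u v : ℤ) ≤ 9 * taxicab u v + 1764 := by
  obtain ⟨p, hp⟩ := exists_crossing_near u
  obtain ⟨q, hq⟩ := exists_crossing_near v
  have h1 := connected_roadGraph.dist_triangle (u := u) (v := crossing p) (w := v)
  have h2 := connected_roadGraph.dist_triangle (u := crossing p) (v := crossing q) (w := v)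
  have h3 := dist_roadGraph_le_taxicab u (crossing p)
  have h4 := dist_roadGraph_le_taxicab (crossing q) v
  have h5 := dist_crossing_le_roadDist p q
  have h6 := mul_roadDist_le_taxicab p q
  have h7 := taxicab_crossing p q
  have h8 := taxicab_triangle (crossing p) u (crossing q)
  have h9 := taxicab_triangle u v (crossing q)
  rw [taxicab_comm (crossing p) u] at h8
  rw [taxicab_comm (crossing q) v] at h4
  omega

/-- The lattice is slower than the roads by a factor of almost 2, so only short stretches can be
geodesic; `252 = 1764 / (16 - 9)`. -/
theorem taxicab_le_of_le_dist {u v : ℤ × ℤ} (h : taxicab u v ≤ roadGraph.dist u v) :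
    taxicab u v ≤ 252 := by
  have := mul_dist_roadGraph_le u v
  omega

/-! ### Transferring the bound to the road graph. -/

theorem dist_add_dist_of_mem_geodesicSlice {u v w : ℤ × ℤ} {k : ℤ}
    (h : w ∈ roadGraph.geodesicSlice u v k) :
    roadGraph.dist u w + roadGraph.dist w v = roadGraph.dist u v := by
  obtain ⟨⟨p, hp, hw⟩, -⟩ := h
  obtain ⟨q, hq⟩ := connected_roadGraph.exists_walk_length_eq_dist u v
  have h1 := hp q
  have h2 := SimpleGraph.dist_le (p.takeUntil w hw)
  have h3 := SimpleGraph.dist_le (p.dropUntil w hw)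
  have h4 := congrArg SimpleGraph.Walk.length (p.take_spec hw)
  rw [SimpleGraph.Walk.length_append] at h4
  have h5 := connected_roadGraph.dist_triangle (u := u) (v := w) (w := v)
  omega

/-- A vertex on a geodesic of the road graph is close to an endpoint or to a crossing on a
geodesic of the road grid. -/
theorem near_or_exists_roadGeodesic {u v w : ℤ × ℤ}
    (h : roadGraph.dist u w + roadGraph.dist w v = roadGraph.dist u v) :
    taxicab u w ≤ 252 ∨ taxicab w v ≤ 252 ∨ ∃ p q r m, taxicab u (crossing p) ≤ 252 ∧
      taxicab v (crossing q) ≤ 252 ∧ 0 ≤ m ∧ m ≤ 504 ∧ taxicab w (crossing r) ≤ 252 ∧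
      roadDist Priority p r = roadGraph.dist u w - m ∧
      roadDist Priority p q = roadDist Priority p r + roadDist Priority r q := by
  rcases taxicab_le_or_exists_dist_eq u w with h1 | ⟨p, r, h1⟩
  · exact Or.inl (taxicab_le_of_le_dist h1)
  rcases taxicab_le_or_exists_dist_eq w v with h2 | ⟨r', q, h2⟩
  · exact Or.inr (Or.inl (taxicab_le_of_le_dist h2))
  refine Or.inr (Or.inr ?_)
  have nonneg : ∀ a b, 0 ≤ taxicab a b := fun a b => by unfold taxicab; positivity
  have a1 := connected_roadGraph.dist_triangle (u := u) (v := crossing p) (w := w)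
  have a2 := connected_roadGraph.dist_triangle (u := crossing p) (v := crossing r) (w := w)
  have a3 := dist_crossing_le_roadDist p r
  have a4 := dist_roadGraph_le_taxicab (crossing r) w
  have a5 := dist_roadGraph_le_taxicab u (crossing p)
  have b1 := connected_roadGraph.dist_triangle (u := w) (v := crossing r') (w := v)
  have b2 := connected_roadGraph.dist_triangle (u := crossing r') (v := crossing q) (w := v)
  have b3 := dist_crossing_le_roadDist r' q
  have b4 := dist_roadGraph_le_taxicab (crossing q) v
  have b5 := dist_roadGraph_le_taxicab w (crossing r')
  -- The lattice ends of the two road trips are themselves geodesic, hence short.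
  have hi : taxicab u (crossing p) ≤ 252 := taxicab_le_of_le_dist (by omega)
  have hj : taxicab (crossing r) w ≤ 252 := taxicab_le_of_le_dist (by omega)
  have hj' : taxicab (crossing q) v ≤ 252 := taxicab_le_of_le_dist (by omega)
  have c1 := connected_roadGraph.dist_triangle (u := u) (v := crossing p) (w := v)
  have c2 := connected_roadGraph.dist_triangle (u := crossing p) (v := crossing q) (w := v)
  have c3 := dist_crossing_le_roadDist p q
  have d1 := roadDist_triangle Priority r r' q
  have d2 := roadDist_triangle Priority p r q
  -- The visit to `w` between the crossings `r` and `r'` is no shorter than the road between them,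
  -- so `r` lies on a road geodesic from `p` to `q`.
  have d3 : roadDist Priority r r' ≤ 2 * taxicab r r' := roadDist_le_two_mul _ _ _
  rw [← taxicab_crossing] at d3
  have d4 := taxicab_triangle (crossing r) w (crossing r')
  refine ⟨p, q, r, taxicab u (crossing p) + taxicab (crossing r) w, hi, ?_, ?_, ?_, ?_, ?_, ?_⟩
  · rwa [taxicab_comm]
  · have := nonneg u (crossing p)
    have := nonneg (crossing r) w
    omega
  · omega
  · rwa [taxicab_comm]
  · omega
  · omega

theorem hasBoundedGeodesicSlices_roadGraph : roadGraph.HasBoundedGeodesicSlices := by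
  classical
  obtain ⟨B, hB⟩ := exists_slice_finset
  choose S hS hmem using hB
  let ball : ℤ × ℤ → Finset (ℤ × ℤ) := fun u =>
    Finset.Icc (u.1 - 252) (u.1 + 252) ×ˢ Finset.Icc (u.2 - 252) (u.2 + 252)
  have hball : ∀ u v, taxicab u v ≤ 252 → v ∈ ball u := by
    intro u v h
    unfold taxicab at h
    have h1 := abs_nonneg (u.1 - v.1)
    have h2 := abs_nonneg (u.2 - v.2)
    have h3 := abs_le.1 (show |u.1 - v.1| ≤ 252 by omega)
    have h4 := abs_le.1 (show |u.2 - v.2| ≤ 252 by omega)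
    simp only [ball, Finset.mem_product, Finset.mem_Icc]
    omega
  have hball_card : ∀ u, (ball u).card ≤ 255025 := by
    intro u
    simp only [ball, Finset.card_product, Int.card_Icc]
    rw [show (u.1 + 252 + 1 - (u.1 - 252)).toNat = 505 by omega,
      show (u.2 + 252 + 1 - (u.2 - 252)).toNat = 505 by omega]
  let half : ℤ × ℤ → Finset (ℤ × ℤ) := fun u =>
    (ball u).image fun p => (p.1 / 2, p.2 / 2)
  have hhalf : ∀ u p, taxicab u (crossing p) ≤ 252 → p ∈ half u := by
    intro u p h
    refine Finset.mem_image.2 ⟨crossing p, hball u _ h, ?_⟩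
    simp [crossing]
  have hhalf_card : ∀ u, (half u).card ≤ 255025 := fun u =>
    Finset.card_image_le.trans (hball_card u)
  -- The end crossings and the total length `m` of two lattice stretches take boundedly many values;
  -- each choice leaves one slice of the road grid for `r`.
  let F : ℤ × ℤ → ℤ × ℤ → ℤ → Finset (ℤ × ℤ) := fun u v k =>
    (half u ×ˢ half v ×ˢ Finset.Icc (0 : ℤ) 504).biUnion fun i =>
      (S i.1 i.2.1 (k - i.2.2)).biUnion fun r => ball (crossing r)
  refine ⟨255025 + 255025 + 255025 * (255025 * 505) * (B * 255025), fun u v k => ?_⟩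
  have hsub : roadGraph.geodesicSlice u v k ⊆ ((ball u ∪ ball v ∪ F u v k : Finset _) : Set _) := by
    intro w hw
    have hk := hw.2
    simp only [Finset.coe_union, Set.mem_union, Finset.mem_coe]
    rcases near_or_exists_roadGeodesic (dist_add_dist_of_mem_geodesicSlice hw) with
      h | h | ⟨p, q, r, m, hp, hq, h0, h1, hr, h2, h3⟩
    · exact Or.inl (Or.inl (hball _ _ h))
    · exact Or.inl (Or.inr (hball _ _ (by rwa [taxicab_comm])))
    · refine Or.inr (Finset.mem_biUnion.2 ⟨(p, q, m), ?_, Finset.mem_biUnion.2 ⟨r, ?_, ?_⟩⟩)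
      · simp only [Finset.mem_product, Finset.mem_Icc]
        exact ⟨hhalf _ _ hp, hhalf _ _ hq, h0, h1⟩
      · exact hmem _ _ _ r (by rw [h2, hk]) h3
      · exact hball _ _ (by rwa [taxicab_comm])
  refine (Set.encard_le_encard hsub).trans ?_
  rw [Set.encard_coe_eq_coe_finsetCard]
  have hF : (F u v k).card ≤ 255025 * (255025 * 505) * (B * 255025) := by
    refine (Finset.card_biUnion_le_card_mul _ _ (B * 255025) fun i _ => ?_).trans ?_
    · refine (Finset.card_biUnion_le_card_mul _ _ 255025 fun r _ => hball_card _).trans ?_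
      exact Nat.mul_le_mul_right _ (hS _ _ _)
    · refine Nat.mul_le_mul_right _ ?_
      rw [Finset.card_product, Finset.card_product, Int.card_Icc]
      exact Nat.mul_le_mul (hhalf_card u) (Nat.mul_le_mul_right _ (hhalf_card v))
  have h1 := Finset.card_union_le (ball u ∪ ball v) (F u v k)
  have h2 := Finset.card_union_le (ball u) (ball v)
  have h3 := hball_card u
  have h4 := hball_card v
  exact_mod_cast (by omega : (ball u ∪ ball v ∪ F u v k).card ≤
    255025 + 255025 + 255025 * (255025 * 505) * (B * 255025))

theorem theorem1p2 : squareLattice.GeodesicallyDirectable :=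
  ⟨roadGraph, isBoundedExtension_roadGraph, hasBoundedGeodesicSlices_roadGraph⟩
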